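/- Let $p\ge 0$, $n=2p$, and let $N$ be a real skew-symmetric $n\times n$ matrix that is invertible and has $n$ distinct complex eigenvalues. Let $\mathrm{Sym}(n)$ be the space of real symmetric $n\times n$ matrices, with the Lie bracket $[X,Y]_N=XNY-YNX$ and identified with its dual by the inner product $\langle\!\langle X,Y\rangle\!\rangle=\operatorname{trace}(XY)$. Let $$\{f,g\}_N(X)=-\operatorname{trace}\bigl(X(\nabla f(X)\,N\,\nabla g(X)-\nabla g(X)\,N\,\nabla f(X))\bigr)$$ be the corresponding Lie–Poisson bracket, where $\nabla$ is the gradient with respect to $\langle\!\langle\cdot,\cdot\rangle\!\rangle$. Its Poisson tensor is $B_X(Y)=XYN-NYX$, so that the Hamiltonian vector field of $h$ is $X\mapsto B_X(\nabla h(X))$. For $1\le k\le n-1$ and $0\le 2r<k$ let $h_{k,2r}(X)$ be the coefficient of $\lambda^{2r}$ in $\frac1k\operatorname{trace}(X+\lambda N)^k$. Then the following hold. 1. The map $X\mapsto NX$ is a Lie algebra isomorphism from $(\mathrm{Sym}(n),[\cdot,\cdot]_N)$ onto the Lie algebra $\mathfrak{sp}(\mathbb R^n,N^{-1})$ of the symplectic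 group $\mathrm{Sp}(\mathbb R^n,N^{-1})=\{g: g^TN^{-1}g=N^{-1}\}$. 2. The equation $\dot X=[X^2,N]$ is the equation of the geodesics on $\mathrm{Sp}(\mathbb R^n,N^{-1})$ of the left-invariant metric that is given at the identity by $\langle\!\langle\cdot,\cdot\rangle\!\rangle$ through $X\mapsto NX$: a smooth curve $g:\mathbb R\to \mathrm{Sp}(\mathbb R^n,N^{-1})$ is a geodesic (that is, on every compact interval it is a critical point of the energy among smooth variations in the group with fixed endpoints) if and only if $X(t)=N^{-1}g(t)^{-1}\dot g(t)$ satisfies $\dot X=[X^2,N]$. 3. On $\mathrm{Sym}(n)$ the equation $\dot X=[X^2,N]$ is the Hamiltonian system, for $\{\cdot,\cdot\}_N$, with Hamiltonian $H(X)=\frac12\operatorname{trace}(X^2)$. 4. There are exactly $p^2$ pairs $(k,r)$ with $1\le k\le n-1$ and $0\le 2r<k$, and the $p^2$ functions $h_{k,2r}$ are in involution with respect to $\{\cdot,\cdot\}_N$. 5. The functions $h_{k,2r}$ are independent and the system is Liouville integrable on the generic symplectic leaf: there is an open dense set $U\subset\mathrm{Sym}(n)$ such that, for every $X\in U$, the differentials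 $dh_{k,2r}(X)$ are linearly independent; the symplectic leaf of $\{\cdot,\cdot\}_N$ through $X$ has dimension $2p^2$; on this leaf the $h_{k,2r}$ Poisson commute with $H$ and with each other; and the differentials of the restrictions of the $h_{k,2r}$ to this leaf are linearly independent at all points of a dense subset of the leaf. -/

import Mathlib

open scoped Matrix Polynomial ContDiff

noncomputable section

namespace SymFlow

/-- `Sym(n)`: the real vector space of symmetric `n × n` matrices. -/
def symSubmodule (n : ℕ) : Submodule ℝ (Matrix (Fin n) (Fin n) ℝ) where
  carrier := {X | Xᵀ = X}
  add_mem' := by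
    intro A B hA hB
    simp only [Set.mem_ofPred_eq] at *
    rw [Matrix.transpose_add, hA, hB]
  zero_mem' := by simp
  smul_mem' := by
    intro c A hA
    simp only [Set.mem_ofPred_eq] at *
    rw [Matrix.transpose_smul, hA]

/-- `Sym(n)` as a type. -/
abbrev Sym (n : ℕ) : Type := symSubmodule n

/-- `so(n)`: the real skew symmetric `n × n` matrices. -/
abbrev Skew (n : ℕ) : Type := LieAlgebra.Orthogonal.so (Fin n) ℝ

theorem skew_transpose {n : ℕ} (N : Skew n) :
    (N : Matrix (Fin n) (Fin n) ℝ)ᵀ = -(N : Matrix (Fin n) (Fin n) ℝ) :=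
  (LieAlgebra.Orthogonal.mem_so (Fin n) ℝ _).1 N.2

/-- `N` has `n` pairwise distinct complex eigenvalues. -/
def DistinctEigenvalues {n : ℕ} (N : Skew n) : Prop :=
  (spectrum ℂ ((N : Matrix (Fin n) (Fin n) ℝ).map Complex.ofReal)).ncard = n

/-! ### The Lie algebra `(Sym(n), [·,·]_N)` and the Lie-Poisson structure on its dual

`Sym(n)` is identified with its dual through the inner product `⟨⟨X, Y⟩⟩ = trace (X * Y)`. -/

/-- The Lie bracket `[X, Y]_N = X N Y - Y N X` on `Sym(n)`. -/
def bracketN {n : ℕ} (N : Skew n) (X Y : Sym n) : Sym n :=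
  ⟨X.1 * N.1 * Y.1 - Y.1 * N.1 * X.1, by
    have hX : X.1ᵀ = X.1 := X.2
    have hY : Y.1ᵀ = Y.1 := Y.2
    change (_ - _)ᵀ = _
    simp only [Matrix.transpose_sub, Matrix.transpose_mul, hX, hY, skew_transpose N]
    noncomm_ring⟩

/-- The symmetric matrix `(E_ij + E_ji) / 2`. -/
def symUnit {n : ℕ} (i j : Fin n) : Sym n :=
  ⟨(1 / 2 : ℝ) • (Matrix.single i j 1 + Matrix.single j i 1), by
    change (_)ᵀ = _
    simp [Matrix.transpose_single, add_comm]⟩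

/-- The gradient of `f` at `X` relative to `⟨⟨X, Y⟩⟩ = trace (X * Y)`: the symmetric matrix whose
`(i, j)` entry `⟨⟨∇f(X), (E_ij + E_ji) / 2⟩⟩` is `df(X)` evaluated at `(E_ij + E_ji) / 2`. -/
def grad {n : ℕ} (f : Sym n → ℝ) (X : Sym n) : Sym n :=
  ⟨Matrix.of fun i j => fderiv ℝ f X (symUnit i j), by
    change (_)ᵀ = _
    ext i j
    simp only [Matrix.transpose_apply, Matrix.of_apply]
    congr 1
    apply Subtype.ext
    simp only [symUnit]
    rw [add_comm]⟩

/-- The (left, or minus) Lie-Poisson bracket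
`{f, g}_N (X) = - ⟨⟨X, [∇f(X), ∇g(X)]_N⟩⟩` on `Sym(n)`. -/
def poissonBracket {n : ℕ} (N : Skew n) (f g : Sym n → ℝ) (X : Sym n) : ℝ :=
  -(X.1 * (bracketN N (grad f X) (grad g X)).1).trace

/-- The Poisson tensor `B_X(Y) = X Y N - N Y X` of the Lie-Poisson bracket at `X`; it satisfies
`{f, g}_N (X) = ⟨⟨∇f(X), B_X(∇g(X))⟩⟩`. -/
def poissonTensor {n : ℕ} (N : Skew n) (X : Sym n) : Sym n →ₗ[ℝ] Sym n where
  toFun Y := ⟨X.1 * Y.1 * N.1 - N.1 * Y.1 * X.1, by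
    have hX : X.1ᵀ = X.1 := X.2
    have hY : Y.1ᵀ = Y.1 := Y.2
    change (_ - _)ᵀ = _
    simp only [Matrix.transpose_sub, Matrix.transpose_mul, hX, hY, skew_transpose N]
    noncomm_ring⟩
  map_add' Y Z := by
    apply Subtype.ext
    simp only [Submodule.coe_add]
    noncomm_ring
  map_smul' c Y := by
    apply Subtype.ext
    simp [smul_sub]

/-- The Hamiltonian vector field `X_h = {·, h}_N`, that is `X ↦ B_X(∇h(X))`. -/
def hamiltonianField {n : ℕ} (N : Skew n) (h : Sym n → ℝ) (X : Sym n) : Sym n :=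
  poissonTensor N X (grad h X)

/-- The symplectic leaf of the Lie-Poisson structure through `X`: all points that can be joined to
`X` by an integral curve `γ' = B_γ(α)` of a time-dependent Hamiltonian vector field. Only the
differential `α(t)` of the time-dependent Hamiltonian at `γ(t)` matters, and every continuous `α` is
attained, by the linear functions `⟨⟨α(t), ·⟩⟩`. -/
def symplecticLeaf {n : ℕ} (N : Skew n) (X : Sym n) : Set (Sym n) :=
  {Y | ∃ γ α : ℝ → Sym n, Continuous α ∧ γ 0 = X ∧ γ 1 = Y ∧
    ∀ t : ℝ, HasDerivAt γ (poissonTensor N (γ t) (α t)) t}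

/-- The tangent space at `Y` of the symplectic leaf through `Y`: the image of the Poisson tensor. -/
def leafTangent {n : ℕ} (N : Skew n) (Y : Sym n) : Submodule ℝ (Sym n) :=
  LinearMap.range (poissonTensor N Y)

/-- The differential at `Y` of the restriction of `f` to the symplectic leaf through `Y`. -/
def leafDifferential {n : ℕ} (N : Skew n) (f : Sym n → ℝ) (Y : Sym n) :
    leafTangent N Y →ₗ[ℝ] ℝ :=
  (fderiv ℝ f Y : Sym n →ₗ[ℝ] ℝ).domRestrict (leafTangent N Y)

/-- Liouville integrability, on the symplectic leaf through `X`, of the Hamiltonian system with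
Hamiltonian `H`, by means of the functions `F i`: their number is half of the dimension of the leaf,
they Poisson commute with `H` and with each other on the leaf, and the differentials of their
restrictions to the leaf are linearly independent on a dense subset of the leaf (this subset is
automatically open in the leaf when the `F i` are continuously differentiable). -/
def LiouvilleIntegrableOnLeaf {n : ℕ} (N : Skew n) (X : Sym n) (H : Sym n → ℝ)
    {ι : Type} [Fintype ι] (F : ι → Sym n → ℝ) : Prop :=
  Module.finrank ℝ (leafTangent N X) = 2 * Fintype.card ι ∧
  (∀ i, ∀ Y ∈ symplecticLeaf N X, poissonBracket N (F i) H Y = 0) ∧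
  (∀ i j, ∀ Y ∈ symplecticLeaf N X, poissonBracket N (F i) (F j) Y = 0) ∧
  symplecticLeaf N X ⊆ closure {Y | Y ∈ symplecticLeaf N X ∧
    LinearIndependent ℝ fun i => leafDifferential N (F i) Y}

/-! ### The Hamiltonian and the integrals -/

/-- The Hamiltonian `(1/2) trace (X²)`. -/
def energyHamiltonian {n : ℕ} (X : Sym n) : ℝ := (1 / 2 : ℝ) * (X.1 ^ 2).trace

/-- `trace (X + λ N)^k` as a polynomial in `λ`. -/
def tracePoly {n : ℕ} (N : Skew n) (k : ℕ) (X : Sym n) : ℝ[X] :=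
  ((X.1.map Polynomial.C + (Polynomial.X : ℝ[X]) • N.1.map Polynomial.C) ^ k).trace

/-- The function `h_{k,2r}`: the coefficient of `λ^{2r}` in `(1/k) trace (X + λ N)^k`. -/
def integral {n : ℕ} (N : Skew n) (k r : ℕ) (X : Sym n) : ℝ :=
  (1 / (k : ℝ)) * (tracePoly N k X).coeff (2 * r)

/-- The pairs `(k, r)` with `1 ≤ k ≤ 2p - 1` and `0 ≤ 2r < k` (which forces `r < p`). -/
abbrev Idx (p : ℕ) : Type :=
  {q : Fin (2 * p) × Fin p // 2 * (q.2 : ℕ) < (q.1 : ℕ)}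

/-- The family of the functions `h_{k,2r}`, `1 ≤ k ≤ 2p - 1`, `0 ≤ 2r < k`, for `n = 2p`. -/
def integrals {p : ℕ} (N : Skew (2 * p)) (i : Idx p) : Sym (2 * p) → ℝ :=
  integral N (i.1.1 : ℕ) (i.1.2 : ℕ)

/-! ### The left-invariant geodesic flow on the symplectic group of `N⁻¹` -/

/-- The group `Sp(ℝⁿ, N⁻¹)` of matrices preserving the symplectic form `N⁻¹`. -/
def spGroup {n : ℕ} (N : Skew n) : Set (Matrix (Fin n) (Fin n) ℝ) :=
  {g | gᵀ * N.1⁻¹ * g = N.1⁻¹}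

/-- The entrywise derivative of a curve of matrices. -/
def velocity {n : ℕ} (g : ℝ → Matrix (Fin n) (Fin n) ℝ) (t : ℝ) : Matrix (Fin n) (Fin n) ℝ :=
  Matrix.of fun i j => deriv (fun u => g u i j) t

/-- The left-trivialized velocity `g⁻¹ g'`, an element of `sp(ℝⁿ, N⁻¹)`, carried to `Sym(n)` by the
inverse of `X ↦ N X`. -/
def bodyVelocity {n : ℕ} (N : Skew n) (g : ℝ → Matrix (Fin n) (Fin n) ℝ) (t : ℝ) :
    Matrix (Fin n) (Fin n) ℝ :=
  N.1⁻¹ * ((g t)⁻¹ * velocity g t)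

/-- The energy on `[a, b]` of a curve in `Sp(ℝⁿ, N⁻¹)`, for the left-invariant metric that is given
at the identity by `⟨⟨X, Y⟩⟩ = trace (X * Y)` through `X ↦ N X`. -/
def curveEnergy {n : ℕ} (N : Skew n) (a b : ℝ) (g : ℝ → Matrix (Fin n) (Fin n) ℝ) : ℝ :=
  (1 / 2 : ℝ) * ∫ t in a..b, (bodyVelocity N g t * bodyVelocity N g t).trace

/-- A smooth curve in `Sp(ℝⁿ, N⁻¹)` is a geodesic of this left-invariant metric: on each compact
interval it is a critical point of the energy among smooth variations in the group with fixed
endpoints. -/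
def IsGeodesic {n : ℕ} (N : Skew n) (g : ℝ → Matrix (Fin n) (Fin n) ℝ) : Prop :=
  ∀ a b : ℝ, a < b → ∀ Γ : ℝ → ℝ → Matrix (Fin n) (Fin n) ℝ,
    (∀ i j, ContDiff ℝ ∞ fun q : ℝ × ℝ => Γ q.1 q.2 i j) →
    (∀ s t, Γ s t ∈ spGroup N) → Γ 0 = g → (∀ s, Γ s a = g a) → (∀ s, Γ s b = g b) →
    HasDerivAt (fun s => curveEnergy N a b (Γ s)) 0 0

end SymFlow

end

/-! Write `M_{m,j}` for the coefficient of `λ^j` in `(X + λN)^m`. The pencil commutes with its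
powers, so `[X, M_{m,j+1}] = [M_{m,j}, N]`. The gradient of `h_{k,2r}` is `M_{k-1,2r}`, and
`B_X(M_{k-1,2r}) = [M_{k,2r}, N]`. The Poisson bracket of two integrals is thus a trace `tr(M_{m,a}
[M_{k,b}, N])`. The commutation relation trades `(a, b+1)` for `(a+1, b)` until `b = 0`, where
`M_{k,0} = X^k` commutes with `X` and the trace is zero (`trace_mixCoeff_mul_lie`).

Everything generic follows from linear independence of the `p²` Hamiltonian vectors `[M_{k,2r}, N]`
at `X` (`flowVec`). Positivity of the trace form turns it into independence of the differentials
restricted to the leaf. Involution then puts `p²` independent vectors into a subspace of codimension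
`p²` of the leaf tangent space, whose dimension is therefore at least `2p²`. For the upper bound,
the `M_{k,2r}` together with the even powers of `N` span a space of dimension `p² + p` that `B_X`
maps into the `p²`-dimensional span of the Hamiltonian vectors. Cayley-Hamilton for the pencil is
what closes this span. So `B_X` has a kernel of dimension at least `p` in a space of dimension at
most `2p² + p`.

One good point is found over `ℂ`. In an eigenbasis of `N` ordered so that eigenvalues `θ, -θ` sit at
opposite places, the Gram matrix is antidiagonal, and a complex symmetric `Z` can be chosen that
acts as a weighted shift. The entries of `M_{s+d,s}` are then nonzero weights times complete
homogeneous polynomials in consecutive eigenvalues, and divided differences reduce their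
independence to Vandermonde. Analytic continuation along `Re Z + s Im Z` from `s = i` to small real
`s` gives a real point.

Analyticity also spreads the good set: along lines it is dense in `Sym(n)`, and along products of
exponentials, which reach every point of a leaf, it is dense in each leaf through a good point.

The geodesic statement is the first variation formula, tested on variations by symplectic
transvections. -/

noncomputable section

namespace SymFlow

/-! ### Powers of the matrix pencil and their commutation relations -/

section Pencil

variable {K : Type*} [CommRing K] {n : ℕ}

/-- The coefficient of `λ^j` in `(X + λ N)^m`. -/
def mixCoeff (X N : Matrix (Fin n) (Fin n) K) (m j : ℕ) : Matrix (Fin n) (Fin n) K :=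
  ((Polynomial.C X + Polynomial.X * Polynomial.C N) ^ m).coeff j

variable (X N : Matrix (Fin n) (Fin n) K)

theorem mixCoeff_zero_zero : mixCoeff X N 0 0 = 1 := by
  simp [mixCoeff]

theorem mixCoeff_zero_succ (j : ℕ) : mixCoeff X N 0 (j + 1) = 0 := by
  simp [mixCoeff, Polynomial.coeff_one]

theorem mixCoeff_succ_zero (m : ℕ) : mixCoeff X N (m + 1) 0 = X * mixCoeff X N m 0 := by
  simp [mixCoeff, pow_succ', Polynomial.mul_coeff_zero]

theorem mixCoeff_succ_zero' (m : ℕ) : mixCoeff X N (m + 1) 0 = mixCoeff X N m 0 * X := by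
  simp [mixCoeff, pow_succ, Polynomial.mul_coeff_zero]

theorem mixCoeff_succ_succ (m j : ℕ) :
    mixCoeff X N (m + 1) (j + 1) = X * mixCoeff X N m (j + 1) + N * mixCoeff X N m j := by
  simp only [mixCoeff, pow_succ', add_mul, Polynomial.coeff_add, Polynomial.coeff_C_mul, mul_assoc,
    Polynomial.coeff_X_mul]

theorem mixCoeff_succ_succ' (m j : ℕ) :
    mixCoeff X N (m + 1) (j + 1) = mixCoeff X N m (j + 1) * X + mixCoeff X N m j * N := by
  simp only [mixCoeff, pow_succ, mul_add, Polynomial.coeff_add, Polynomial.coeff_mul_C,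
    ← mul_assoc, Polynomial.coeff_mul_X]

theorem mixCoeff_eq_zero {m j : ℕ} (h : m < j) : mixCoeff X N m j = 0 := by
  induction m generalizing j with
  | zero =>
    obtain ⟨j, rfl⟩ := Nat.exists_eq_succ_of_ne_zero h.ne'
    exact mixCoeff_zero_succ X N j
  | succ m ih =>
    obtain ⟨j, rfl⟩ := Nat.exists_eq_succ_of_ne_zero (Nat.ne_zero_of_lt h)
    rw [mixCoeff_succ_succ, ih (by omega), ih (by omega), mul_zero, mul_zero, add_zero]

theorem mixCoeff_self (m : ℕ) : mixCoeff X N m m = N ^ m := by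
  induction m with
  | zero => rw [mixCoeff_zero_zero, pow_zero]
  | succ m ih =>
    rw [mixCoeff_succ_succ, ih, mixCoeff_eq_zero X N (Nat.lt_succ_self m), mul_zero, zero_add,
      pow_succ']

theorem mixCoeff_one_zero : mixCoeff X N 1 0 = X := by
  rw [mixCoeff_succ_zero, mixCoeff_zero_zero, mul_one]

theorem mixCoeff_two_zero : mixCoeff X N 2 0 = X ^ 2 := by
  rw [mixCoeff_succ_zero, mixCoeff_one_zero, sq]

/-- Transposition reverses products and sends `X + λN` to `X - λN`, so it acts on powers of the
pencil as `λ ↦ -λ`. -/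
theorem mixCoeff_transpose {X N : Matrix (Fin n) (Fin n) K} (hX : Xᵀ = X) (hN : Nᵀ = -N)
    (m j : ℕ) : (mixCoeff X N m j)ᵀ = (-1 : K) ^ j • mixCoeff X N m j := by
  induction m generalizing j with
  | zero =>
    cases j with
    | zero => simp [mixCoeff_zero_zero]
    | succ j => simp [mixCoeff_zero_succ]
  | succ m ih =>
    cases j with
    | zero =>
      rw [mixCoeff_succ_zero, Matrix.transpose_mul, ih, hX, ← mixCoeff_succ_zero, pow_zero,
        one_smul, one_smul, mixCoeff_succ_zero']
    | succ j =>
      conv_lhs => rw [mixCoeff_succ_succ]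
      rw [Matrix.transpose_add, Matrix.transpose_mul, Matrix.transpose_mul, ih, ih, hX, hN,
        mixCoeff_succ_succ', smul_add, pow_succ]
      simp

theorem mixCoeff_transpose_even {X N : Matrix (Fin n) (Fin n) K} (hX : Xᵀ = X) (hN : Nᵀ = -N)
    (m r : ℕ) : (mixCoeff X N m (2 * r))ᵀ = mixCoeff X N m (2 * r) := by
  rw [mixCoeff_transpose hX hN, pow_mul]
  simp

theorem commute_mixCoeff_zero (m : ℕ) : X * mixCoeff X N m 0 = mixCoeff X N m 0 * X := by
  rw [← mixCoeff_succ_zero, mixCoeff_succ_zero']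

/-- The coefficient of `λ^(j+1)` in the commutation of the pencil with its `m`-th power; this is the
recursion behind involution. -/
theorem commute_mixCoeff_succ (m j : ℕ) :
    X * mixCoeff X N m (j + 1) + N * mixCoeff X N m j =
      mixCoeff X N m (j + 1) * X + mixCoeff X N m j * N := by
  rw [← mixCoeff_succ_succ, mixCoeff_succ_succ']

/-- With `A = X + λN`, the terms `λ N A^m N` cancel in `A^(m+1) N - N A^(m+1)`, leaving `X A^m N - N
A^m X`. -/
theorem sandwich_mixCoeff (m j : ℕ) :
    X * mixCoeff X N m j * N - N * mixCoeff X N m j * X = ⁅mixCoeff X N (m + 1) j, N⁆ := by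
  rw [Ring.lie_def]
  cases j with
  | zero =>
    conv_rhs => rw [mixCoeff_succ_zero]
    rw [commute_mixCoeff_zero]
    noncomm_ring
  | succ j =>
    conv_rhs => enter [1]; rw [mixCoeff_succ_succ]
    conv_rhs => enter [2]; rw [mixCoeff_succ_succ']
    noncomm_ring

/-- Cyclicity moves the commutator with `N` onto the first factor, the recursion turns it into one
with `X`, and cyclicity moves that one back onto the second factor. Each round raises `a` and lowers
`b` by one; at `b = 0` the second factor commutes with `X`. -/
theorem trace_mixCoeff_mul_lie (m a k b : ℕ) :
    (mixCoeff X N m a * ⁅mixCoeff X N k b, N⁆).trace = 0 := by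
  have key : ∀ Z W : Matrix (Fin n) (Fin n) K,
      (Z * ⁅W, N⁆).trace = ((N * Z - Z * N) * W).trace := by
    intro Z W
    have h1 : (N * Z * W).trace = (Z * W * N).trace := by
      rw [Matrix.mul_assoc, Matrix.trace_mul_comm]
    simp only [Ring.lie_def, mul_sub, sub_mul, Matrix.trace_sub, h1, ← Matrix.mul_assoc]
  have step : ∀ a, N * mixCoeff X N m a - mixCoeff X N m a * N =
      mixCoeff X N m (a + 1) * X - X * mixCoeff X N m (a + 1) := by
    intro a
    rw [sub_eq_sub_iff_add_eq_add, add_comm, commute_mixCoeff_succ]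
  have cyc : ∀ Z W : Matrix (Fin n) (Fin n) K,
      ((Z * X - X * Z) * W).trace = (Z * (X * W - W * X)).trace := by
    intro Z W
    have h1 : (X * Z * W).trace = (Z * W * X).trace := by
      rw [Matrix.mul_assoc, Matrix.trace_mul_comm]
    simp only [mul_sub, sub_mul, Matrix.trace_sub, h1, ← Matrix.mul_assoc]
  induction b generalizing a with
  | zero => rw [key, step, cyc, commute_mixCoeff_zero, sub_self, mul_zero, Matrix.trace_zero]
  | succ b ih =>
    have h2 : X * mixCoeff X N k (b + 1) - mixCoeff X N k (b + 1) * X = ⁅mixCoeff X N k b, N⁆ := by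
      rw [Ring.lie_def, sub_eq_sub_iff_add_eq_add, commute_mixCoeff_succ, add_comm]
    rw [key, step, cyc, h2, ih]

theorem mixCoeff_mul_of_semiconj {X N S T P : Matrix (Fin n) (Fin n) K} (hX : X * P = P * S)
    (hN : N * P = P * T) (m j : ℕ) : mixCoeff X N m j * P = P * mixCoeff S T m j := by
  induction m generalizing j with
  | zero =>
    cases j with
    | zero => simp [mixCoeff_zero_zero]
    | succ j => simp [mixCoeff_zero_succ]
  | succ m ih =>
    cases j with
    | zero => rw [mixCoeff_succ_zero, mixCoeff_succ_zero, mul_assoc, ih, ← mul_assoc, hX, mul_assoc]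
    | succ j =>
      rw [mixCoeff_succ_succ, mixCoeff_succ_succ, add_mul, mul_assoc, ih, mul_assoc, ih,
        ← mul_assoc, hX, ← mul_assoc, hN, mul_add, mul_assoc, mul_assoc]

theorem mixCoeff_map {L : Type*} [CommRing L] (f : K →+* L) (m j : ℕ) :
    mixCoeff (X.map f) (N.map f) m j = (mixCoeff X N m j).map f := by
  induction m generalizing j with
  | zero =>
    cases j with
    | zero => simp [mixCoeff_zero_zero]
    | succ j => simp [mixCoeff_zero_succ]
  | succ m ih =>
    cases j with
    | zero => rw [mixCoeff_succ_zero, mixCoeff_succ_zero, ih, Matrix.map_mul]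
    | succ j =>
      rw [mixCoeff_succ_succ, mixCoeff_succ_succ, ih, ih, Matrix.map_add f (map_add f),
        Matrix.map_mul, Matrix.map_mul]

/-- The matrix pencil `X + λ N` with entries in `K[λ]`. -/
def pencil : Matrix (Fin n) (Fin n) K[X] :=
  X.map Polynomial.C + (Polynomial.X : K[X]) • N.map Polynomial.C

theorem matPolyEquiv_pencil :
    matPolyEquiv (pencil X N) = Polynomial.C X + Polynomial.X * Polynomial.C N := by
  ext1 k
  ext i j
  rw [matPolyEquiv_coeff_apply]
  rcases k with _ | k
  · simp [pencil]
  · simp [pencil, Polynomial.coeff_C, Matrix.add_apply]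
    split_ifs <;> simp

theorem coeff_pencil_pow (m r : ℕ) (i j : Fin n) :
    ((pencil X N ^ m) i j).coeff r = mixCoeff X N m r i j := by
  rw [← matPolyEquiv_coeff_apply, map_pow, matPolyEquiv_pencil, mixCoeff]

theorem coeff_trace_pencil_pow (m r : ℕ) :
    (pencil X N ^ m).trace.coeff r = (mixCoeff X N m r).trace := by
  simp [Matrix.trace, coeff_pencil_pow]

/-- Cayley-Hamilton over `K[λ]` expresses the `n`-th power of the pencil by lower powers, with
coefficients polynomial in `λ`; the coefficient of `λ^r` is the claim. -/
theorem mixCoeff_mem_span (r : ℕ) :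
    mixCoeff X N n r ∈
      Submodule.span K {Z | ∃ m j, m < n ∧ Z = mixCoeff X N m j} := by
  nontriviality K
  have hCH := Matrix.aeval_self_charpoly (pencil X N)
  have hdeg : (pencil X N).charpoly.natDegree = n := by
    rw [Matrix.charpoly_natDegree_eq_dim, Fintype.card_fin]
  rw [Polynomial.aeval_eq_sum_range, hdeg, Finset.sum_range_succ] at hCH
  have hlead : (pencil X N).charpoly.coeff n = 1 := by
    have h := (Matrix.charpoly_monic (pencil X N)).coeff_natDegree
    rwa [hdeg] at h
  rw [hlead, one_smul] at hCH
  have : mixCoeff X N n r = -∑ i ∈ Finset.range n, ∑ q ∈ Finset.HasAntidiagonal.antidiagonal r,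
      ((pencil X N).charpoly.coeff i).coeff q.1 • mixCoeff X N i q.2 := by
    rw [eq_neg_iff_add_eq_zero, add_comm]
    ext a b
    have h := congrArg (fun M : Matrix (Fin n) (Fin n) K[X] => (M a b).coeff r) hCH
    simp only [Matrix.add_apply, Matrix.sum_apply, Matrix.smul_apply, Polynomial.coeff_add,
      Polynomial.finsetSum_coeff, smul_eq_mul, Polynomial.coeff_mul, coeff_pencil_pow,
      Matrix.zero_apply, Polynomial.coeff_zero] at h ⊢
    exact h
  rw [this]
  refine Submodule.neg_mem _ (Submodule.sum_mem _ fun i hi => Submodule.sum_mem _ fun q _ =>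
    Submodule.smul_mem _ _ (Submodule.subset_span ⟨i, q.2, Finset.mem_range.1 hi, rfl⟩))

end Pencil

theorem trace_coeff_mul_comm {K : Type*} [CommRing K] {n : ℕ}
    (p q : (Matrix (Fin n) (Fin n) K)[X]) (j : ℕ) :
    ((p * q).coeff j).trace = ((q * p).coeff j).trace := by
  rw [Polynomial.coeff_mul, Polynomial.coeff_mul, Matrix.trace_sum, Matrix.trace_sum,
    ← Finset.Nat.sum_antidiagonal_swap]
  exact Finset.sum_congr rfl fun u _ => Matrix.trace_mul_comm _ _

/-! ### Gradients of the integrals -/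

section Gradient

open scoped Matrix.Norms.Operator

variable {n : ℕ}

/-- The differential of `X ↦ mixCoeff X N m j` in the direction `Y`. -/
def mixVariation (X N Y : Matrix (Fin n) (Fin n) ℝ) (m j : ℕ) : Matrix (Fin n) (Fin n) ℝ :=
  (∑ a ∈ Finset.range m, (Polynomial.C X + Polynomial.X * Polynomial.C N) ^ a * Polynomial.C Y *
    (Polynomial.C X + Polynomial.X * Polynomial.C N) ^ (m - 1 - a)).coeff j

theorem sum_variation_succ {R : Type*} [Ring R] (A Y : R) (m : ℕ) :
    ∑ a ∈ Finset.range (m + 1), A ^ a * Y * A ^ (m + 1 - 1 - a) =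
      (∑ a ∈ Finset.range m, A ^ a * Y * A ^ (m - 1 - a)) * A + A ^ m * Y := by
  rw [Finset.sum_range_succ, Finset.sum_mul]
  congr 1
  · refine Finset.sum_congr rfl fun a ha => ?_
    have : m + 1 - 1 - a = (m - 1 - a) + 1 := by have := Finset.mem_range.1 ha; omega
    rw [this, pow_succ, ← mul_assoc]
  · simp

theorem mixVariation_zero (X N Y : Matrix (Fin n) (Fin n) ℝ) (j : ℕ) :
    mixVariation X N Y 0 j = 0 := by
  simp [mixVariation]

theorem mixVariation_succ_zero (X N Y : Matrix (Fin n) (Fin n) ℝ) (m : ℕ) :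
    mixVariation X N Y (m + 1) 0 = mixVariation X N Y m 0 * X + mixCoeff X N m 0 * Y := by
  rw [mixVariation, sum_variation_succ]
  simp [mixVariation, mixCoeff, Polynomial.mul_coeff_zero]

theorem mixVariation_succ_succ (X N Y : Matrix (Fin n) (Fin n) ℝ) (m j : ℕ) :
    mixVariation X N Y (m + 1) (j + 1) =
      mixVariation X N Y m (j + 1) * X + mixVariation X N Y m j * N +
        mixCoeff X N m (j + 1) * Y := by
  rw [mixVariation, sum_variation_succ]
  simp only [mixVariation, mixCoeff, mul_add, Polynomial.coeff_add, Polynomial.coeff_mul_C,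
    ← mul_assoc, Polynomial.coeff_mul_X]

/-- Cyclicity of the trace makes the `m` terms of the Leibniz expansion equal. -/
theorem trace_mixVariation (X N Y : Matrix (Fin n) (Fin n) ℝ) (m j : ℕ) :
    (mixVariation X N Y m j).trace = m * (mixCoeff X N (m - 1) j * Y).trace := by
  rw [mixVariation, Polynomial.finsetSum_coeff, Matrix.trace_sum]
  rw [Finset.sum_congr rfl (g := fun _ => (mixCoeff X N (m - 1) j * Y).trace), Finset.sum_const,
    Finset.card_range, nsmul_eq_mul]
  intro a ha
  have : m - 1 - a + a = m - 1 := by have := Finset.mem_range.1 ha; omega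
  rw [trace_coeff_mul_comm, ← mul_assoc, ← pow_add, this, Polynomial.coeff_mul_C, mixCoeff]

theorem hasFDerivAt_mixCoeff (N : Matrix (Fin n) (Fin n) ℝ) (m j : ℕ) (X : Sym n) :
    ∃ D : Sym n →L[ℝ] Matrix (Fin n) (Fin n) ℝ,
      HasFDerivAt (fun Z : Sym n => mixCoeff Z.1 N m j) D X ∧
        ∀ Y : Sym n, D Y = mixVariation X.1 N Y.1 m j := by
  have hsub : HasFDerivAt (fun Z : Sym n => Z.1) (symSubmodule n).subtypeL X :=
    (symSubmodule n).subtypeL.hasFDerivAt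
  induction m generalizing j with
  | zero =>
    refine ⟨0, ?_, fun Y => by rw [mixVariation_zero]; rfl⟩
    cases j with
    | zero => simpa only [mixCoeff_zero_zero] using hasFDerivAt_const _ X
    | succ j => simpa only [mixCoeff_zero_succ] using hasFDerivAt_const _ X
  | succ m ih =>
    cases j with
    | zero =>
      obtain ⟨D, hD, hDY⟩ := ih 0
      have h := hD.mul' hsub
      simp only [mixCoeff_succ_zero']
      refine ⟨_, h, fun Y => ?_⟩
      rw [mixVariation_succ_zero, ← hDY]
      change mixCoeff X.1 N m 0 * Y.1 + D Y * X.1 = _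
      rw [add_comm]
    | succ j =>
      obtain ⟨D, hD, hDY⟩ := ih (j + 1)
      obtain ⟨E, hE, hEY⟩ := ih j
      have h := (hD.mul' hsub).add (hE.mul_const' N)
      simp only [mixCoeff_succ_succ']
      refine ⟨_, h, fun Y => ?_⟩
      rw [mixVariation_succ_succ, ← hDY, ← hEY]
      change (mixCoeff X.1 N m (j + 1) * Y.1 + D Y * X.1) + E Y * N = _
      abel

/-- The trace form `Y ↦ trace (G Y)` as a continuous linear functional on `Sym(n)`. -/
def traceFunctional (G : Matrix (Fin n) (Fin n) ℝ) : Sym n →L[ℝ] ℝ :=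
  LinearMap.toContinuousLinearMap
    ((Matrix.traceLinearMap (Fin n) ℝ ℝ).comp
      ((LinearMap.mulLeft ℝ G).comp (symSubmodule n).subtype))

theorem traceFunctional_apply (G : Matrix (Fin n) (Fin n) ℝ) (Y : Sym n) :
    traceFunctional G Y = (G * Y.1).trace := rfl

theorem trace_mul_symUnit (G : Sym n) (i j : Fin n) : (G.1 * (symUnit i j).1).trace = G.1 i j := by
  have hG : G.1 j i = G.1 i j := congrFun (congrFun (G.2 : G.1ᵀ = G.1) i) j
  simp only [symUnit, Matrix.mul_smul, mul_add, Matrix.trace_smul, Matrix.trace_add,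
    Matrix.trace_mul_single, smul_eq_mul, MulOpposite.op_one, one_smul, hG]
  ring

/-- A symmetric matrix is recovered from its trace pairings with the units `symUnit i j`. -/
theorem grad_eq {f : Sym n → ℝ} {X : Sym n} (G : Sym n)
    (h : HasFDerivAt f (traceFunctional G.1) X) : grad f X = G := by
  apply Subtype.ext
  ext i j
  simp only [grad, Matrix.of_apply]
  rw [h.fderiv, traceFunctional_apply, trace_mul_symUnit]

theorem integral_eq (N : Skew n) (k r : ℕ) (X : Sym n) :
    integral N k r X = (1 / (k : ℝ)) * (mixCoeff X.1 N.1 k (2 * r)).trace := by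
  rw [integral, tracePoly, ← coeff_trace_pencil_pow]
  rfl

/-- The even coefficient `mixCoeff X N m (2 r)` as a symmetric matrix. -/
def symCoeff (N : Skew n) (X : Sym n) (m r : ℕ) : Sym n :=
  ⟨mixCoeff X.1 N.1 m (2 * r), mixCoeff_transpose_even X.2 (skew_transpose N) m r⟩

/-- The factor `1/k` cancels the `k` equal terms of the traced variation, so the gradient is a
coefficient of the pencil's power `k - 1`. -/
theorem hasFDerivAt_integral (N : Skew n) {k : ℕ} (hk : k ≠ 0) (r : ℕ) (X : Sym n) :
    HasFDerivAt (integral N k r) (traceFunctional (symCoeff N X (k - 1) r).1) X := by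
  obtain ⟨D, hD, hDY⟩ := hasFDerivAt_mixCoeff N.1 k (2 * r) X
  have h := ((Matrix.traceLinearMap (Fin n) ℝ ℝ).toContinuousLinearMap.hasFDerivAt.comp X
    hD).const_mul (1 / (k : ℝ))
  have heq : integral N k r = fun Z => (1 / (k : ℝ)) *
      ((Matrix.traceLinearMap (Fin n) ℝ ℝ).toContinuousLinearMap ∘
        fun Z : Sym n => mixCoeff Z.1 N.1 k (2 * r)) Z := by
    funext Z
    rw [integral_eq]
    rfl
  rw [heq]
  refine h.congr_fderiv ?_
  ext Y
  have hk' : (k : ℝ) ≠ 0 := Nat.cast_ne_zero.2 hk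
  change (1 / (k : ℝ)) * (D Y).trace = ((symCoeff N X (k - 1) r).1 * Y.1).trace
  rw [hDY, trace_mixVariation]
  simp only [symCoeff]
  field_simp

theorem grad_integral (N : Skew n) {k : ℕ} (hk : k ≠ 0) (r : ℕ) (X : Sym n) :
    grad (integral N k r) X = symCoeff N X (k - 1) r :=
  grad_eq _ (hasFDerivAt_integral N hk r X)

/-- This makes commutation with `H` a case of `poissonBracket_integral`, even for `p = 1`, where the
pair `(2, 0)` lies outside `Idx p`. -/
theorem energyHamiltonian_eq (N : Skew n) :
    (energyHamiltonian : Sym n → ℝ) = integral N 2 0 := by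
  funext X
  rw [integral_eq, mul_zero, mixCoeff_two_zero, energyHamiltonian]
  norm_num

theorem grad_energyHamiltonian (N : Skew n) (X : Sym n) :
    grad energyHamiltonian X = symCoeff N X 1 0 := by
  rw [energyHamiltonian_eq N, grad_integral N two_ne_zero]

end Gradient

/-! ### The Poisson tensor, involution, and the Lie algebra isomorphism -/

section Poisson

variable {n : ℕ} (N : Skew n)

theorem poissonBracket_eq_trace (f g : Sym n → ℝ) (X : Sym n) :
    poissonBracket N f g X = ((grad f X).1 * (poissonTensor N X (grad g X)).1).trace := by
  have h : ∀ F G : Matrix (Fin n) (Fin n) ℝ,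
      -(X.1 * (F * N.1 * G - G * N.1 * F)).trace = (F * (X.1 * G * N.1 - N.1 * G * X.1)).trace := by
    intro F G
    have h1 : (X.1 * F * N.1 * G).trace = (F * N.1 * G * X.1).trace := by
      rw [Matrix.mul_assoc, Matrix.mul_assoc, Matrix.trace_mul_comm, ← Matrix.mul_assoc F]
    have h2 : (X.1 * G * N.1 * F).trace = (F * X.1 * G * N.1).trace := by
      rw [Matrix.trace_mul_comm]
      simp only [Matrix.mul_assoc]
    simp only [mul_sub, Matrix.trace_sub, ← Matrix.mul_assoc, h1, h2]
    ring
  exact h _ _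

theorem trace_mul_poissonTensor (X Y Z : Sym n) :
    (Z.1 * (poissonTensor N X Y).1).trace = -(Y.1 * (poissonTensor N X Z).1).trace := by
  change (Z.1 * (X.1 * Y.1 * N.1 - N.1 * Y.1 * X.1)).trace =
    -(Y.1 * (X.1 * Z.1 * N.1 - N.1 * Z.1 * X.1)).trace
  have h : ∀ A B : Matrix (Fin n) (Fin n) ℝ,
      (A * X.1 * B * N.1).trace = (B * N.1 * A * X.1).trace := by
    intro A B
    rw [Matrix.mul_assoc, Matrix.trace_mul_comm, ← Matrix.mul_assoc]
  simp only [mul_sub, Matrix.trace_sub, ← Matrix.mul_assoc, h]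
  ring

theorem poissonTensor_symCoeff (X : Sym n) (m r : ℕ) :
    (poissonTensor N X (symCoeff N X m r)).1 = ⁅mixCoeff X.1 N.1 (m + 1) (2 * r), N.1⁆ :=
  sandwich_mixCoeff X.1 N.1 m (2 * r)

theorem poissonBracket_integral {k l : ℕ} (hk : k ≠ 0) (hl : l ≠ 0) (r s : ℕ) (X : Sym n) :
    poissonBracket N (integral N k r) (integral N l s) X = 0 := by
  rw [poissonBracket_eq_trace, grad_integral N hk, grad_integral N hl, poissonTensor_symCoeff]
  exact trace_mixCoeff_mul_lie _ _ _ _ _ _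

theorem hamiltonianField_energyHamiltonian (X : Sym n) :
    (hamiltonianField N energyHamiltonian X).1 = ⁅X.1 ^ 2, N.1⁆ := by
  rw [hamiltonianField, grad_energyHamiltonian N, poissonTensor_symCoeff, mul_zero,
    mixCoeff_two_zero]

theorem bracketN_mul (X Y : Sym n) : N.1 * (bracketN N X Y).1 = ⁅N.1 * X.1, N.1 * Y.1⁆ := by
  rw [Ring.lie_def]
  change N.1 * (X.1 * N.1 * Y.1 - Y.1 * N.1 * X.1) = _
  noncomm_ring

theorem transpose_inv_skew : (N.1⁻¹)ᵀ = -N.1⁻¹ := by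
  rw [Matrix.transpose_nonsing_inv, skew_transpose]
  by_cases h : IsUnit N.1.det
  · exact Matrix.inv_eq_right_inv (by rw [neg_mul_neg, Matrix.mul_nonsing_inv _ h])
  -- For singular `N` both inverses are `0` by convention.
  · have h' : ¬IsUnit (-N.1).det := by
      rwa [← skew_transpose, Matrix.det_transpose]
    rw [Matrix.nonsing_inv_apply_not_isUnit _ h, Matrix.nonsing_inv_apply_not_isUnit _ h', neg_zero]

variable {N}

theorem mul_left_injective_sym (h : IsUnit N.1.det) :
    Function.Injective (fun X : Sym n => N.1 * X.1) := fun X Y hXY => Subtype.ext <| by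
  have := congrArg (N.1⁻¹ * ·) hXY
  simpa only [Matrix.nonsing_inv_mul_cancel_left _ _ h] using this

theorem range_mul_left_sym (h : IsUnit N.1.det) :
    Set.range (fun X : Sym n => N.1 * X.1) =
      (skewAdjointMatricesLieSubalgebra N.1⁻¹ : Set (Matrix (Fin n) (Fin n) ℝ)) := by
  ext A
  simp only [Set.mem_range, SetLike.mem_coe, mem_skewAdjointMatricesLieSubalgebra,
    mem_skewAdjointMatricesSubmodule]
  change _ ↔ Aᵀ * N.1⁻¹ = N.1⁻¹ * -A
  constructor
  · rintro ⟨X, rfl⟩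
    rw [Matrix.transpose_mul, (X.2 : X.1ᵀ = X.1), skew_transpose, mul_neg, neg_mul, mul_neg,
      Matrix.nonsing_inv_mul_cancel_left _ _ h, Matrix.mul_nonsing_inv_cancel_right _ _ h]
  · intro hA
    refine ⟨⟨N.1⁻¹ * A, ?_⟩, Matrix.mul_nonsing_inv_cancel_left _ _ h⟩
    change (_)ᵀ = _
    rw [Matrix.transpose_mul, transpose_inv_skew, mul_neg, hA, mul_neg, neg_neg]

end Poisson

/-! ### Number of integrals -/

/-- For fixed `r` there are `2(p - 1 - r) + 1` admissible `k`; over all `r` these are the first `p`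
odd numbers. -/
theorem card_idx (p : ℕ) : Fintype.card (Idx p) = p ^ 2 := by
  have e : Idx p ≃ Σ r : Fin p, {k : Fin (2 * p) // 2 * (r : ℕ) < k} :=
    { toFun := fun q => ⟨q.1.2, q.1.1, q.2⟩
      invFun := fun q => ⟨(q.2.1, q.1), q.2.2⟩
      left_inv := fun _ => rfl
      right_inv := fun _ => rfl }
  rw [Fintype.card_congr e, Fintype.card_sigma]
  have : ∀ r : Fin p, Fintype.card {k : Fin (2 * p) // 2 * (r : ℕ) < k} = 2 * (p - 1 - r) + 1 := by
    intro r
    have hr : 2 * (r : ℕ) < 2 * p := by have := r.2; omega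
    have := Fin.card_Ioi (⟨2 * r, hr⟩ : Fin (2 * p))
    rw [Fintype.card_subtype]
    rw [show (2 * (p - 1 - (r : ℕ)) + 1) = 2 * p - 1 - 2 * r by have := r.2; omega]
    simp only at this
    rw [← this]
    congr 1
    ext k
    simp [Fin.lt_def]
  rw [Finset.sum_congr rfl fun r _ => this r, Fin.sum_univ_eq_sum_range (fun r => 2 * (p - 1 - r) + 1),
    Finset.sum_range_reflect (fun r => 2 * r + 1) p]
  induction p with
  | zero => rfl
  | succ p ih =>
    rw [Finset.sum_range_succ]
    have : ∑ x ∈ Finset.range p, (2 * x + 1) = p ^ 2 := by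
      clear ih this e
      induction p with
      | zero => rfl
      | succ p ih => rw [Finset.sum_range_succ, ih]; ring
    rw [this]; ring

/-! ### Linear algebra of the symmetric coefficients -/

section LeafAlgebra

variable {n : ℕ} (N : Skew n)

theorem eq_zero_of_trace_mul_self {S : Sym n} (h : (S.1 * S.1).trace = 0) : S = 0 := by
  have hS : S.1ᴴ = S.1 := by
    rw [Matrix.conjTranspose_eq_transpose_of_trivial]; exact S.2
  apply Subtype.ext
  exact Matrix.trace_conjTranspose_mul_self_eq_zero_iff.1 (by rw [hS, h])

/-- Entries are indexed by unordered pairs. Only the upper bound matters for the rank count. -/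
theorem finrank_sym_le (n : ℕ) : Module.finrank ℝ (Sym n) ≤ n * (n + 1) / 2 := by
  let f : Sym n →ₗ[ℝ] (Sym2 (Fin n) → ℝ) :=
    { toFun := fun X => Sym2.lift ⟨fun i j => X.1 i j, fun i j =>
        (congrFun (congrFun (X.2 : X.1ᵀ = X.1) i) j).symm⟩
      map_add' := fun X Y => by
        ext q; induction q using Sym2.ind with | _ i j => rfl
      map_smul' := fun c X => by
        ext q; induction q using Sym2.ind with | _ i j => rfl }
  have hf : Function.Injective f := fun X Y h => Subtype.ext <| by
    ext i j
    exact congrFun h s(i, j)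
  have h := LinearMap.finrank_le_finrank_of_injective hf
  rw [Module.finrank_fintype_fun_eq_card, Sym2.card, Fintype.card_fin, Nat.choose_two_right] at h
  simpa [mul_comm] using h

/-- The map `Z ↦ [Z, N]` on `Sym(n)`. -/
def lieSkew : Sym n →ₗ[ℝ] Sym n where
  toFun Z := ⟨⁅Z.1, N.1⁆, by
    have hZ : Z.1ᵀ = Z.1 := Z.2
    change (_)ᵀ = _
    simp only [Ring.lie_def, Matrix.transpose_sub, Matrix.transpose_mul, hZ, skew_transpose N]
    noncomm_ring⟩
  map_add' Y Z := Subtype.ext <| by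
    change ⁅Y.1 + Z.1, N.1⁆ = ⁅Y.1, N.1⁆ + ⁅Z.1, N.1⁆
    simp only [Ring.lie_def, add_mul, mul_add, add_sub_add_comm]
  map_smul' c Y := Subtype.ext <| by
    change ⁅c • Y.1, N.1⁆ = c • ⁅Y.1, N.1⁆
    simp only [Ring.lie_def, smul_mul_assoc, mul_smul_comm, smul_sub]

theorem poissonTensor_symCoeff' (X : Sym n) (m r : ℕ) :
    poissonTensor N X (symCoeff N X m r) = lieSkew N (symCoeff N X (m + 1) r) :=
  Subtype.ext (poissonTensor_symCoeff N X m r)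

/-- The symmetric part of a matrix. -/
def symPart (n : ℕ) : Matrix (Fin n) (Fin n) ℝ →ₗ[ℝ] Sym n where
  toFun Z := ⟨(1 / 2 : ℝ) • (Z + Zᵀ), by
    change (_)ᵀ = _
    simp [add_comm]⟩
  map_add' Y Z := Subtype.ext <| by
    change (1 / 2 : ℝ) • (Y + Z + (Y + Z)ᵀ) = (1 / 2 : ℝ) • (Y + Yᵀ) + (1 / 2 : ℝ) • (Z + Zᵀ)
    rw [← smul_add, Matrix.transpose_add, add_add_add_comm]
  map_smul' c Y := Subtype.ext <| by
    change (1 / 2 : ℝ) • (c • Y + (c • Y)ᵀ) = c • (1 / 2 : ℝ) • (Y + Yᵀ)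
    rw [Matrix.transpose_smul, ← smul_add, smul_comm]

theorem symPart_mixCoeff_even (X : Sym n) (m r : ℕ) :
    symPart n (mixCoeff X.1 N.1 m (2 * r)) = symCoeff N X m r := Subtype.ext <| by
  change (1 / 2 : ℝ) • (_ + _) = mixCoeff X.1 N.1 m (2 * r)
  rw [mixCoeff_transpose_even X.2 (skew_transpose N), ← two_smul ℝ, smul_smul]
  norm_num

theorem symPart_mixCoeff_odd (X : Sym n) (m r : ℕ) :
    symPart n (mixCoeff X.1 N.1 m (2 * r + 1)) = 0 := Subtype.ext <| by
  change (1 / 2 : ℝ) • (_ + _) = (0 : Matrix (Fin n) (Fin n) ℝ)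
  rw [mixCoeff_transpose X.2 (skew_transpose N), pow_succ, pow_mul]
  simp

/-- Taking symmetric parts in the Cayley-Hamilton relation removes the odd coefficients, which are
skew, and keeps the even ones. -/
theorem symCoeff_mem_span (X : Sym n) (r : ℕ) :
    symCoeff N X n r ∈ Submodule.span ℝ {Z | ∃ m s, m < n ∧ Z = symCoeff N X m s} := by
  rw [← symPart_mixCoeff_even]
  have h := mixCoeff_mem_span X.1 N.1 (2 * r)
  have hle : Submodule.span ℝ {Z | ∃ m j, m < n ∧ Z = mixCoeff X.1 N.1 m j} ≤
      (Submodule.span ℝ {Z | ∃ m s, m < n ∧ Z = symCoeff N X m s}).comap (symPart n) := by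
    rw [Submodule.span_le]
    rintro Z ⟨m, j, hm, rfl⟩
    rcases Nat.even_or_odd' j with ⟨s, rfl | rfl⟩
    · rw [SetLike.mem_coe, Submodule.mem_comap, symPart_mixCoeff_even]
      exact Submodule.subset_span ⟨m, s, hm, rfl⟩
    · rw [SetLike.mem_coe, Submodule.mem_comap, symPart_mixCoeff_odd]
      exact Submodule.zero_mem _
  exact hle h

/-- Such a coefficient is either the power `N^m` or zero. -/
theorem lieSkew_symCoeff_self (X : Sym n) {m r : ℕ} (h : m ≤ 2 * r) :
    lieSkew N (symCoeff N X m r) = 0 := Subtype.ext <| by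
  change ⁅mixCoeff X.1 N.1 m (2 * r), N.1⁆ = 0
  rcases h.eq_or_lt with rfl | h
  · rw [mixCoeff_self, Ring.lie_def, ← pow_succ, ← pow_succ', sub_self]
  · rw [mixCoeff_eq_zero _ _ h, Ring.lie_def, zero_mul, mul_zero, sub_zero]

end LeafAlgebra

/-! ### Consequences of independent Hamiltonian vectors -/

section Independence

variable {p : ℕ} (N : Skew (2 * p))

/-- The Hamiltonian vector field `[mixCoeff X N k (2 r), N]` of the integral `h_{k,2r}`. -/
def flowVec (X : Sym (2 * p)) (i : Idx p) : Sym (2 * p) :=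
  lieSkew N (symCoeff N X i.1.1 i.1.2)

theorem idx_ne_zero (i : Idx p) : (i.1.1 : ℕ) ≠ 0 := Nat.ne_zero_of_lt i.2

theorem flowVec_eq (X : Sym (2 * p)) (i : Idx p) :
    flowVec N X i = poissonTensor N X (grad (integrals N i) X) := by
  rw [integrals, grad_integral N (idx_ne_zero i), poissonTensor_symCoeff',
    Nat.sub_add_cancel (Nat.one_le_iff_ne_zero.2 (idx_ne_zero i)), flowVec]

theorem fderiv_integrals (X Y : Sym (2 * p)) (i : Idx p) :
    fderiv ℝ (integrals N i) X Y = ((grad (integrals N i) X).1 * Y.1).trace := by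
  rw [integrals, grad_integral N (idx_ne_zero i), (hasFDerivAt_integral N (idx_ne_zero i) _ X).fderiv,
    traceFunctional_apply]

theorem leafDifferential_poissonTensor (X Y : Sym (2 * p)) (i : Idx p) :
    leafDifferential N (integrals N i) X ⟨poissonTensor N X Y, LinearMap.mem_range_self _ _⟩ =
      -(Y.1 * (flowVec N X i).1).trace := by
  change fderiv ℝ (integrals N i) X (poissonTensor N X Y) = _
  rw [fderiv_integrals, trace_mul_poissonTensor, flowVec_eq]

variable {N} {X : Sym (2 * p)}

/-- With `S = ∑ c_i X_i` the combination of Hamiltonian vectors, the functional `∑ c_i dh_i` takes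
the value `-tr(S²)` at the tangent vector `B_X(S)`. If it vanishes on the leaf, then `S = 0`. -/
theorem linearIndependent_leafDifferential (h : LinearIndependent ℝ (flowVec N X)) :
    LinearIndependent ℝ fun i => leafDifferential N (integrals N i) X := by
  rw [Fintype.linearIndependent_iff] at h ⊢
  intro c hc
  apply h
  set S : Sym (2 * p) := ∑ i, c i • flowVec N X i with hS
  apply eq_zero_of_trace_mul_self
  have h0 := LinearMap.congr_fun hc ⟨poissonTensor N X S, LinearMap.mem_range_self _ _⟩
  simp only [LinearMap.sum_apply, LinearMap.smul_apply, leafDifferential_poissonTensor,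
    LinearMap.zero_apply, smul_eq_mul, mul_neg, Finset.sum_neg_distrib, neg_eq_zero] at h0
  have h1 : S.1 = ∑ i, c i • (flowVec N X i).1 := by
    rw [hS, AddSubmonoidClass.coe_finsetSum]; rfl
  conv_lhs => enter [1, 2]; rw [h1]
  rw [Finset.mul_sum, Matrix.trace_sum, ← h0]
  simp only [Matrix.mul_smul, Matrix.trace_smul, smul_eq_mul]

theorem linearIndependent_fderiv (h : LinearIndependent ℝ (flowVec N X)) :
    LinearIndependent ℝ fun i => fderiv ℝ (integrals N i) X := by
  let f : (Sym (2 * p) →L[ℝ] ℝ) →ₗ[ℝ] (leafTangent N X →ₗ[ℝ] ℝ) :=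
    { toFun := fun φ => (φ : Sym (2 * p) →ₗ[ℝ] ℝ).domRestrict (leafTangent N X)
      map_add' := fun _ _ => rfl
      map_smul' := fun _ _ => rfl }
  exact LinearIndependent.of_comp f (linearIndependent_leafDifferential h)

/-- The differentials are `p²` independent functionals on the tangent space, so their common kernel
has codimension `p²`; by involution it contains the `p²` independent Hamiltonian vectors. -/
theorem le_finrank_leafTangent (h : LinearIndependent ℝ (flowVec N X)) :
    2 * p ^ 2 ≤ Module.finrank ℝ (leafTangent N X) := by
  have h1 := linearIndependent_leafDifferential h
  set W : Subspace ℝ (Module.Dual ℝ (leafTangent N X)) :=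
    Submodule.span ℝ (Set.range fun i => leafDifferential N (integrals N i) X) with hW
  have hWrank : Module.finrank ℝ W = p ^ 2 := by
    rw [hW, finrank_span_eq_card h1, card_idx]
  have hsum := Subspace.finrank_add_finrank_dualCoannihilator_eq (K := ℝ)
    (V := leafTangent N X) W
  let u : Idx p → W.dualCoannihilator := fun i =>
    ⟨⟨flowVec N X i, flowVec_eq N X i ▸ LinearMap.mem_range_self _ _⟩, by
      rw [Submodule.mem_dualCoannihilator]
      intro φ hφ
      rw [hW] at hφ
      induction hφ using Submodule.span_induction with
      | mem φ hφ =>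
        obtain ⟨j, rfl⟩ := hφ
        change fderiv ℝ (integrals N j) X (flowVec N X i) = 0
        rw [fderiv_integrals, flowVec_eq, ← poissonBracket_eq_trace]
        exact poissonBracket_integral N (idx_ne_zero j) (idx_ne_zero i) _ _ X
      | zero => rfl
      | add φ ψ _ _ h1 h2 => rw [LinearMap.add_apply, h1, h2, add_zero]
      | smul c φ _ h1 => rw [LinearMap.smul_apply, h1, smul_zero]⟩
  have hu : LinearIndependent ℝ u :=
    LinearIndependent.of_comp ((leafTangent N X).subtype.comp W.dualCoannihilator.subtype) h
  have := hu.fintype_card_le_finrank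
  rw [card_idx] at this
  omega

/-- By spectral mapping the polynomial vanishes at `n` distinct complex eigenvalues, more than its
degree allows. -/
theorem eq_zero_of_aeval_eq_zero {n : ℕ} {N : Skew n} (hdist : DistinctEigenvalues N) {q : ℝ[X]}
    (hdeg : q.natDegree < n) (hq : Polynomial.aeval N.1 q = 0) : q = 0 := by
  set M := N.1.map Complex.ofReal with hM
  have hn : n ≠ 0 := Nat.ne_zero_of_lt hdeg
  have : Nonempty (Fin n) := ⟨⟨0, Nat.pos_of_ne_zero hn⟩⟩
  have hfin : (spectrum ℂ M).Finite := Set.finite_of_ncard_ne_zero (by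
    have : (spectrum ℂ M).ncard = n := hdist
    rwa [this])
  have hMq : Polynomial.aeval M (q.map (algebraMap ℝ ℂ)) = 0 := by
    have h1 := Polynomial.aeval_algHom_apply (Algebra.ofId ℝ ℂ).mapMatrix N.1 q
    rw [hq, map_zero] at h1
    rw [Polynomial.aeval_map_algebraMap]
    exact h1
  have hroot : ∀ z ∈ hfin.toFinset, (q.map (algebraMap ℝ ℂ)).eval z = 0 := by
    intro z hz
    have h2 := spectrum.subset_polynomial_aeval M (q.map (algebraMap ℝ ℂ))
      ⟨z, hfin.mem_toFinset.1 hz, rfl⟩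
    rw [hMq, spectrum.zero_eq] at h2
    exact h2
  have hcard : hfin.toFinset.card = n := by
    rw [← Set.ncard_eq_toFinset_card _ hfin]
    exact hdist
  have := Polynomial.eq_zero_of_natDegree_lt_card_of_eval_eq_zero' (q.map (algebraMap ℝ ℂ))
    hfin.toFinset hroot (by rw [Polynomial.natDegree_map, hcard]; exact hdeg)
  exact (Polynomial.map_eq_zero _).1 this

theorem linearIndependent_even_powers (hdist : DistinctEigenvalues N) :
    LinearIndependent ℝ fun r : Fin p => symCoeff N X (2 * r) r := by
  rw [Fintype.linearIndependent_iff]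
  intro c hc r
  have hp : 0 < p := Nat.pos_of_ne_zero (Nat.ne_zero_of_lt r.2)
  set q : ℝ[X] := ∑ r : Fin p, Polynomial.monomial (2 * (r : ℕ)) (c r) with hq
  have h0 : q = 0 := by
    apply eq_zero_of_aeval_eq_zero hdist
    · refine lt_of_le_of_lt (Polynomial.natDegree_sum_le_of_forall_le (n := 2 * p - 1) _ _ ?_)
        (by omega)
      intro i _
      exact (Polynomial.natDegree_monomial_le _).trans (by have := i.2; omega)
    · rw [hq, map_sum]
      have h1 := congrArg Subtype.val hc
      rw [AddSubmonoidClass.coe_finsetSum] at h1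
      refine Eq.trans (Finset.sum_congr rfl fun i _ => ?_) h1
      rw [Polynomial.aeval_monomial, ← Algebra.smul_def]
      change _ = c i • mixCoeff X.1 N.1 (2 * i) (2 * i)
      rw [mixCoeff_self]
  have h2 := congrArg (fun f : ℝ[X] => f.coeff (2 * (r : ℕ))) h0
  simp only [hq, Polynomial.finsetSum_coeff, Polynomial.coeff_monomial, Polynomial.coeff_zero] at h2
  rw [Finset.sum_eq_single r] at h2
  · simpa using h2
  · intro b _ hb
    rw [if_neg]
    intro h
    exact hb (Fin.ext (by omega))
  · simp

/-- For `m < 2p` the vector is zero or one of the family; only `m = 2p` needs Cayley-Hamilton. -/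
theorem lieSkew_symCoeff_mem {m : ℕ} (hm : m ≤ 2 * p) (r : ℕ) :
    lieSkew N (symCoeff N X m r) ∈ Submodule.span ℝ (Set.range (flowVec N X)) := by
  have hlt : ∀ m r, m < 2 * p →
      lieSkew N (symCoeff N X m r) ∈ Submodule.span ℝ (Set.range (flowVec N X)) := by
    intro m r hm
    rcases le_or_gt m (2 * r) with h | h
    · rw [lieSkew_symCoeff_self N X h]
      exact Submodule.zero_mem _
    · exact Submodule.subset_span ⟨⟨(⟨m, hm⟩, ⟨r, by omega⟩), h⟩, rfl⟩
  rcases hm.lt_or_eq with h | rfl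
  · exact hlt m r h
  · have hle : Submodule.span ℝ {Z | ∃ m s, m < 2 * p ∧ Z = symCoeff N X m s} ≤
        (Submodule.span ℝ (Set.range (flowVec N X))).comap (lieSkew N) := by
      rw [Submodule.span_le]
      rintro Z ⟨m, s, hm, rfl⟩
      exact hlt m s hm
    exact hle (symCoeff_mem_span N X r)

theorem finrank_leafTangent_le (hdist : DistinctEigenvalues N)
    (h : LinearIndependent ℝ (flowVec N X)) :
    Module.finrank ℝ (leafTangent N X) ≤ 2 * p ^ 2 := by
  -- The extra `p` vectors are the even powers `N^(2r)`, `r < p`. They are killed by `[·, N]`, which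
  -- separates them from the first `p²`.
  let v : Idx p ⊕ Fin p → Sym (2 * p) :=
    Sum.elim (fun i => symCoeff N X i.1.1 i.1.2) (fun r => symCoeff N X (2 * r) r)
  have hv : LinearIndependent ℝ v := by
    rw [Fintype.linearIndependent_iff]
    intro c hc
    rw [Fintype.sum_sum_type] at hc
    simp only [v, Sum.elim_inl, Sum.elim_inr] at hc
    have h1 := congrArg (lieSkew N) hc
    rw [map_add, map_sum, map_sum, map_zero] at h1
    simp only [map_smul, lieSkew_symCoeff_self N X le_rfl, smul_zero, Finset.sum_const_zero,
      add_zero] at h1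
    have h2 := Fintype.linearIndependent_iff.1 h (fun i => c (Sum.inl i)) h1
    simp only [h2, zero_smul, Finset.sum_const_zero, zero_add] at hc
    have h3 := Fintype.linearIndependent_iff.1 (linearIndependent_even_powers hdist)
      (fun i => c (Sum.inr i)) hc
    rintro (i | r)
    exacts [h2 i, h3 r]
  set V := Submodule.span ℝ (Set.range v) with hV
  have hVrank : Module.finrank ℝ V = p ^ 2 + p := by
    rw [hV, finrank_span_eq_card hv, Fintype.card_sum, card_idx, Fintype.card_fin]
  set W := Submodule.span ℝ (Set.range (flowVec N X)) with hW
  have hWrank : Module.finrank ℝ W = p ^ 2 := by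
    rw [hW, finrank_span_eq_card h, card_idx]
  have hmap : V.map (poissonTensor N X) ≤ W := by
    rw [hV, Submodule.map_span, Submodule.span_le]
    rintro _ ⟨_, ⟨i | r, rfl⟩, rfl⟩
    · change poissonTensor N X (symCoeff N X _ _) ∈ W
      rw [poissonTensor_symCoeff']
      exact lieSkew_symCoeff_mem (by have := i.1.1.2; omega) _
    · change poissonTensor N X (symCoeff N X _ _) ∈ W
      rw [poissonTensor_symCoeff']
      exact lieSkew_symCoeff_mem (by have := r.2; omega) _
  have h1 := LinearMap.finrank_range_add_finrank_ker (K := ℝ) (V := V)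
    ((poissonTensor N X).domRestrict V)
  have h2 : Module.finrank ℝ (LinearMap.range ((poissonTensor N X).domRestrict V)) ≤ p ^ 2 := by
    rw [LinearMap.range_domRestrict, ← hWrank]
    exact Submodule.finrank_mono hmap
  have h3 : Module.finrank ℝ (LinearMap.ker ((poissonTensor N X).domRestrict V)) ≤
      Module.finrank ℝ (LinearMap.ker (poissonTensor N X)) := by
    rw [LinearMap.ker_domRestrict]
    have := Submodule.finrank_map_subtype_eq V ((LinearMap.ker (poissonTensor N X)).comap V.subtype)
    rw [← this]
    apply Submodule.finrank_mono
    rintro _ ⟨x, hx, rfl⟩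
    exact hx
  -- On the `(p² + p)`-dimensional `V` the rank is at most `p²`, so the kernel of `B_X` has
  -- dimension at least `p`. Subtracting from `dim Sym ≤ 2p² + p` bounds the rank.
  have h4 := LinearMap.finrank_range_add_finrank_ker (poissonTensor N X)
  have h5 := finrank_sym_le (2 * p)
  have h6 : 2 * p * (2 * p + 1) / 2 = 2 * p ^ 2 + p := by
    rw [Nat.div_eq_of_eq_mul_left two_pos]
    ring
  rw [hVrank] at h1
  rw [h6] at h5
  change Module.finrank ℝ (LinearMap.range (poissonTensor N X)) ≤ _
  omega

theorem finrank_leafTangent (hdist : DistinctEigenvalues N)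
    (h : LinearIndependent ℝ (flowVec N X)) :
    Module.finrank ℝ (leafTangent N X) = 2 * p ^ 2 :=
  le_antisymm (finrank_leafTangent_le hdist h) (le_finrank_leafTangent h)

end Independence

/-! ### Analytic families of matrices and persistence of independence -/

section AnalyticFamilies

variable {𝕜 : Type*} [NontriviallyNormedField 𝕜] {n : ℕ}

/-- A matrix-valued function with analytic entries. -/
def EntryAnalytic (f : 𝕜 → Matrix (Fin n) (Fin n) 𝕜) : Prop :=
  ∀ a b s, AnalyticAt 𝕜 (fun s => f s a b) s

theorem EntryAnalytic.const (M : Matrix (Fin n) (Fin n) 𝕜) : EntryAnalytic fun _ : 𝕜 => M :=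
  fun _ _ _ => analyticAt_const

theorem EntryAnalytic.add {f g : 𝕜 → Matrix (Fin n) (Fin n) 𝕜} (hf : EntryAnalytic f)
    (hg : EntryAnalytic g) : EntryAnalytic fun s => f s + g s :=
  fun a b s => (hf a b s).add (hg a b s)

theorem EntryAnalytic.sub {f g : 𝕜 → Matrix (Fin n) (Fin n) 𝕜} (hf : EntryAnalytic f)
    (hg : EntryAnalytic g) : EntryAnalytic fun s => f s - g s :=
  fun a b s => (hf a b s).sub (hg a b s)

theorem EntryAnalytic.transpose {f : 𝕜 → Matrix (Fin n) (Fin n) 𝕜} (hf : EntryAnalytic f) :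
    EntryAnalytic fun s => (f s)ᵀ :=
  fun a b s => hf b a s

theorem EntryAnalytic.mul {f g : 𝕜 → Matrix (Fin n) (Fin n) 𝕜} (hf : EntryAnalytic f)
    (hg : EntryAnalytic g) : EntryAnalytic fun s => f s * g s := by
  intro a b s
  simp only [Matrix.mul_apply]
  exact Finset.analyticAt_fun_sum _ fun c _ => (hf a c s).mul (hg c b s)

theorem EntryAnalytic.id_smul (M : Matrix (Fin n) (Fin n) 𝕜) :
    EntryAnalytic fun s : 𝕜 => s • M :=
  fun _ _ _ => analyticAt_id.mul analyticAt_const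

theorem EntryAnalytic.mixCoeff {f : 𝕜 → Matrix (Fin n) (Fin n) 𝕜} (hf : EntryAnalytic f)
    (N : Matrix (Fin n) (Fin n) 𝕜) (m j : ℕ) : EntryAnalytic fun s => mixCoeff (f s) N m j := by
  induction m generalizing j with
  | zero =>
    cases j with
    | zero => simpa only [mixCoeff_zero_zero] using EntryAnalytic.const 1
    | succ j => simpa only [mixCoeff_zero_succ] using EntryAnalytic.const 0
  | succ m ih =>
    cases j with
    | zero => simpa only [mixCoeff_succ_zero] using hf.mul (ih 0)
    | succ j =>
      simpa only [mixCoeff_succ_succ] using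
        (hf.mul (ih (j + 1))).add ((EntryAnalytic.const N).mul (ih j))

theorem EntryAnalytic.lie_const {f : 𝕜 → Matrix (Fin n) (Fin n) 𝕜} (hf : EntryAnalytic f)
    (N : Matrix (Fin n) (Fin n) 𝕜) : EntryAnalytic fun s => ⁅f s, N⁆ := by
  simp only [Ring.lie_def]
  exact (hf.mul (EntryAnalytic.const N)).sub ((EntryAnalytic.const N).mul hf)

/-- A left inverse `g` of the coordinate map at `s₁` gives a square matrix `F s` with analytic
entries and `F s₁ = 1`. Where `det F ≠ 0` the family is independent, and by the identity theorem the
zeros of `det F` do not accumulate at `s₀`. -/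
theorem eventually_linearIndependent [PreconnectedSpace 𝕜] {ι : Type*} [Fintype ι]
    {w : ι → 𝕜 → Matrix (Fin n) (Fin n) 𝕜} (hw : ∀ i, EntryAnalytic (w i)) {s₁ : 𝕜}
    (h : LinearIndependent 𝕜 fun i => w i s₁) (s₀ : 𝕜) :
    ∀ᶠ s in nhdsWithin s₀ {s₀}ᶜ, LinearIndependent 𝕜 fun i => w i s := by
  classical
  obtain ⟨g, hg⟩ := LinearMap.exists_leftInverse_of_injective
    (Fintype.linearCombination 𝕜 fun i => w i s₁)
    (LinearMap.ker_eq_bot.2 (LinearIndependent.fintypeLinearCombination_injective h))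
  let F : 𝕜 → Matrix ι ι 𝕜 := fun s => Matrix.of fun i j => g (w i s) j
  have hF : ∀ i j s, AnalyticAt 𝕜 (fun s => F s i j) s := by
    intro i j s
    have : (fun s => F s i j) =
        fun s => ∑ a, ∑ b, w i s a b * g (Matrix.single a b 1) j := by
      funext s
      change g (w i s) j = _
      conv_lhs => rw [Matrix.matrix_eq_sum_single (w i s)]
      simp only [map_sum, Finset.sum_apply]
      refine Finset.sum_congr rfl fun a _ => Finset.sum_congr rfl fun b _ => ?_
      rw [← mul_one (w i s a b), ← smul_eq_mul, ← Matrix.smul_single, map_smul]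
      simp
    rw [this]
    exact Finset.analyticAt_fun_sum _ fun a _ => Finset.analyticAt_fun_sum _ fun b _ =>
      (hw i a b s).mul analyticAt_const
  have hdet : AnalyticOnNhd 𝕜 (fun s => (F s).det) Set.univ := by
    intro s _
    simp only [Matrix.det_apply']
    exact Finset.analyticAt_fun_sum _ fun σ _ =>
      analyticAt_const.mul (Finset.analyticAt_fun_prod _ fun i _ => hF _ _ s)
  have h1 : (F s₁).det ≠ 0 := by
    have : F s₁ = 1 := by
      ext i j
      have := congrFun (LinearMap.congr_fun hg (Pi.single i 1)) j
      rw [LinearMap.comp_apply, Fintype.linearCombination_apply_single, one_smul,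
        LinearMap.id_apply] at this
      change g (w i s₁) j = _
      rw [this, Matrix.one_apply, Pi.single_apply]
      exact if_congr eq_comm rfl rfl
    rw [this, Matrix.det_one]
    exact one_ne_zero
  have h2 : ∀ᶠ s in nhdsWithin s₀ {s₀}ᶜ, (F s).det ≠ 0 := by
    by_contra hcon
    exact h1 (hdet.eqOn_zero_of_preconnected_of_frequently_eq_zero isPreconnected_univ
      (Set.mem_univ s₀) (Filter.not_eventually.1 hcon |>.mono fun s => not_not.1) (Set.mem_univ s₁))
  filter_upwards [h2] with s hs
  rw [Fintype.linearIndependent_iff]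
  intro c hc
  refine congrFun (Matrix.eq_zero_of_vecMul_eq_zero hs (v := c) ?_)
  ext j
  have := congrFun (congrArg g hc) j
  rw [map_sum, map_zero, Finset.sum_apply] at this
  simpa [Matrix.vecMul, dotProduct, F] using this

end AnalyticFamilies

/-! ### Complete homogeneous polynomials in consecutive eigenvalues -/

section CompleteHomogeneous

variable {K : Type*} [Field K]

/-- The complete homogeneous symmetric polynomial of degree `s` in `θ a, …, θ (a + d)`. -/
def completeHom (θ : ℕ → K) : ℕ → ℕ → ℕ → K
  | 0, _, _ => 1
  | s + 1, a, 0 => θ a ^ (s + 1)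
  | s + 1, a, d + 1 => completeHom θ (s + 1) (a + 1) d + θ a * completeHom θ s a (d + 1)

variable (θ : ℕ → K)

theorem completeHom_zero (a d : ℕ) : completeHom θ 0 a d = 1 := by
  rw [completeHom]

theorem completeHom_single (s a : ℕ) : completeHom θ s a 0 = θ a ^ s := by
  cases s with
  | zero => rw [completeHom, pow_zero]
  | succ s => rw [completeHom]

theorem completeHom_succ_succ (s a d : ℕ) : completeHom θ (s + 1) a (d + 1) =
    completeHom θ (s + 1) (a + 1) d + θ a * completeHom θ s a (d + 1) := by
  rw [completeHom]

/-- By symmetry in the variables, the last one can be split off instead of the first, which the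
recursive definition splits off. -/
theorem completeHom_succ_succ' (s a d : ℕ) : completeHom θ (s + 1) a (d + 1) =
    completeHom θ (s + 1) a d + θ (a + d + 1) * completeHom θ s a (d + 1) := by
  induction d generalizing a s with
  | zero =>
    induction s with
    | zero =>
      rw [completeHom_succ_succ, completeHom_single, completeHom_single, completeHom_zero]
      ring_nf
    | succ s ih =>
      have h1 := completeHom_succ_succ θ (s + 1) a 0
      have h2 := completeHom_succ_succ θ s a 0
      simp only [completeHom_single, add_zero] at h1 h2 ih ⊢
      linear_combination h1 + θ a * ih - θ (a + 1) * h2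
  | succ d ihd =>
    have e : a + 1 + d + 1 = a + (d + 1) + 1 := by ring
    induction s with
    | zero =>
      rw [completeHom_succ_succ, ihd, e]
      conv_rhs => rw [completeHom_succ_succ]
      simp only [completeHom_zero]
      ring
    | succ s ihs =>
      have h1 := completeHom_succ_succ θ (s + 1) a (d + 1)
      have h2 := ihd (s + 1) (a + 1)
      have h3 := completeHom_succ_succ θ (s + 1) a d
      have h4 := completeHom_succ_succ θ s a (d + 1)
      rw [e] at h2
      linear_combination h1 + h2 + θ a * ihs - h3 - θ (a + (d + 1) + 1) * h4

/-- The divided difference identity: comparing the two ways of splitting off a variable. -/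
theorem completeHom_sub (s a d : ℕ) :
    (θ (a + d + 1) - θ a) * completeHom θ s a (d + 1) =
      completeHom θ (s + 1) (a + 1) d - completeHom θ (s + 1) a d := by
  have h := (completeHom_succ_succ θ s a d).symm.trans (completeHom_succ_succ' θ s a d)
  linear_combination -h

/-- Each window length `d + 1` relation is a divided difference of window length `d` sums, which are
thus constant in `a`. Subtracting the constant gives a relation of window length `d`; at `d = 0` the
system is Vandermonde. -/
theorem eq_zero_of_sum_completeHom {n : ℕ} (hθ : ∀ i < n, ∀ j < n, θ i = θ j → i = j) (d : ℕ)
    (c : ℕ → K)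
    (hc : ∀ a, a + d < n → ∑ s ∈ Finset.range (n - d), c s * completeHom θ s a d = 0) :
    ∀ s < n - d, c s = 0 := by
  induction d generalizing c with
  | zero =>
    have h := Matrix.eq_zero_of_forall_index_sum_mul_pow_eq_zero (f := fun i : Fin n => θ i)
      (v := fun i : Fin n => c i) (fun i j h => Fin.ext (hθ i i.2 j j.2 h)) (fun j => by
        have := hc j j.2
        rw [Nat.sub_zero, Finset.sum_range] at this
        simpa only [completeHom_single] using this)
    intro s hs
    exact congrFun h ⟨s, hs⟩
  | succ d ih =>
    intro s hs
    obtain ⟨l, hl⟩ : ∃ l, n - d = l + 1 := ⟨n - d - 1, by omega⟩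
    have hl' : n - (d + 1) = l := by omega
    rw [hl'] at hc hs
    -- The coefficients move up one degree, and the new degree-zero coefficient cancels the common
    -- value of the sums.
    let c' : ℕ → K := fun s =>
      Nat.casesOn s (-∑ s ∈ Finset.range l, c s * completeHom θ (s + 1) 0 d) c
    have hsum : ∀ a, a + d < n → ∑ s ∈ Finset.range l, c s * completeHom θ (s + 1) a d =
        ∑ s ∈ Finset.range l, c s * completeHom θ (s + 1) 0 d := by
      intro a
      induction a with
      | zero => exact fun _ => rfl
      | succ a iha =>
        intro ha
        rw [← iha (by omega), ← sub_eq_zero, ← Finset.sum_sub_distrib]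
        have := congrArg ((θ (a + d + 1) - θ a) * ·) (hc a (by omega))
        simp only [mul_zero, Finset.mul_sum] at this
        rw [← this]
        refine Finset.sum_congr rfl fun s _ => ?_
        rw [mul_left_comm, completeHom_sub, mul_sub]
    have := ih c' (fun a ha => by
      rw [hl, Finset.sum_range_succ', ← sub_eq_zero.2 (hsum a ha)]
      simp only [c', completeHom_zero, mul_one]
      rw [sub_eq_add_neg]
      rfl) (s + 1) (by omega)
    exact this

end CompleteHomogeneous

/-! ### The model pair: weighted shift and diagonal matrix -/

section WeightedShift

variable {n : ℕ} (θ γ : ℕ → ℂ)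

/-- The weighted shift with superdiagonal entries `γ 1, …, γ (n - 1)`. -/
def weightedShift (n : ℕ) (γ : ℕ → ℂ) : Matrix (Fin n) (Fin n) ℂ :=
  Matrix.of fun i j => if (j : ℕ) = i + 1 then γ j else 0

theorem weightedShift_mul_apply (M : Matrix (Fin n) (Fin n) ℂ) (a b : Fin n) :
    (weightedShift n γ * M) a b =
      if h : (a : ℕ) + 1 < n then γ (a + 1) * M ⟨a + 1, h⟩ b else 0 := by
  rw [Matrix.mul_apply]
  split_ifs with h
  · rw [Finset.sum_eq_single ⟨a + 1, h⟩]
    · simp [weightedShift]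
    · intro c _ hc
      have : (c : ℕ) ≠ a + 1 := fun h' => hc (Fin.ext h')
      simp [weightedShift, this]
    · simp
  · refine Finset.sum_eq_zero fun c _ => ?_
    have : (c : ℕ) ≠ a + 1 := fun h' => h (h' ▸ c.2)
    simp [weightedShift, this]

/-- A word with `d` shifts and `s` diagonal letters moves `a` to `a + d`, collecting the same
weights wherever the diagonal letters stand; summing over their positions gives the complete
homogeneous polynomial in `θ a, …, θ (a + d)`. -/
theorem mixCoeff_weightedShift (s d : ℕ) (a b : Fin n) :
    mixCoeff (weightedShift n γ) (Matrix.diagonal fun i : Fin n => θ i) (s + d) s a b =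
      if (b : ℕ) = a + d then
        (∏ k ∈ Finset.range d, γ (a + 1 + k)) * completeHom θ s a d else 0 := by
  obtain ⟨m, hm⟩ : ∃ m, m = s + d := ⟨_, rfl⟩
  induction m generalizing s d a b with
  | zero =>
    obtain ⟨rfl, rfl⟩ : s = 0 ∧ d = 0 := by omega
    rw [mixCoeff_zero_zero, completeHom_zero, Matrix.one_apply]
    simp only [Fin.ext_iff, Finset.range_zero, Finset.prod_empty, mul_one, add_zero]
    exact if_congr eq_comm rfl rfl
  | succ m ih =>
    rcases d with _ | d
    · rw [add_zero, mixCoeff_self, Matrix.diagonal_pow, Matrix.diagonal_apply, completeHom_single]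
      simp only [Fin.ext_iff, Finset.range_zero, Finset.prod_empty, one_mul, add_zero, Pi.pow_apply]
      exact if_congr eq_comm rfl rfl
    · have hprod : ∏ k ∈ Finset.range (d + 1), γ (a + 1 + k) =
          γ (a + 1) * ∏ k ∈ Finset.range d, γ (a + 1 + 1 + k) := by
        rw [Finset.prod_range_succ', mul_comm, add_zero]
        simp only [add_comm, add_left_comm]
      rcases s with _ | s
      · have e : 0 + (d + 1) = 0 + d + 1 := rfl
        rw [e, mixCoeff_succ_zero, weightedShift_mul_apply]
        split_ifs with h1 h2 h2
        · rw [ih 0 d _ _ (by omega), if_pos (by simp only; omega), hprod, completeHom_zero,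
            completeHom_zero, mul_one, mul_one]
        · rw [ih 0 d _ _ (by omega), if_neg (by simp only; omega), mul_zero]
        · have := b.2; omega
        · rfl
      · have e : s + 1 + (d + 1) = (s + 1 + d) + 1 := rfl
        have e' : s + 1 + d = s + (d + 1) := by ring
        rw [e, mixCoeff_succ_succ, Matrix.add_apply, weightedShift_mul_apply,
          Matrix.diagonal_mul]
        conv_lhs => rw [e', ih s (d + 1) a b (by omega), ← e']
        split_ifs with h1 h2 h2
        · rw [ih (s + 1) d _ _ (by omega), if_pos (by simp only; omega), hprod,
            completeHom_succ_succ]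
          ring
        · rw [ih (s + 1) d _ _ (by omega), if_neg (by simp only; omega), mul_zero, mul_zero,
            add_zero]
        · have := b.2; omega
        · rw [mul_zero, add_zero]

/-- Indices with different `d = k - 2r` live on different superdiagonals. On the `d`-th one,
bracketing with the diagonal matrix multiplies by `θ (a + d) - θ a`, nonzero because `d > 0`, and a
relation among complete homogeneous polynomials remains. -/
theorem linearIndependent_weightedShift {p : ℕ} (hγ : ∀ i, γ i ≠ 0)
    (hθ : ∀ i < 2 * p, ∀ j < 2 * p, θ i = θ j → i = j) :
    LinearIndependent ℂ fun i : Idx p =>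
      ⁅mixCoeff (weightedShift (2 * p) γ) (Matrix.diagonal fun i : Fin (2 * p) => θ i)
        i.1.1 (2 * i.1.2), Matrix.diagonal fun i : Fin (2 * p) => θ i⁆ := by
  rw [Fintype.linearIndependent_iff]
  intro c hc i₀
  obtain ⟨d, hd⟩ : ∃ d, (i₀.1.1 : ℕ) = 2 * i₀.1.2 + d := ⟨_, (Nat.add_sub_cancel' i₀.2.le).symm⟩
  have hd0 : 0 < d := by have := i₀.2; omega
  -- The coefficients belonging to the `d`-th superdiagonal, by degree `s = 2r`; odd degrees get
  -- `0`.
  let c' : ℕ → ℂ := fun s => ∑ i : Idx p,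
    if 2 * (i.1.2 : ℕ) = s ∧ (i.1.1 : ℕ) = s + d then c i else 0
  have hc' := eq_zero_of_sum_completeHom θ hθ d c' (by
    intro a ha
    have h1 := congrFun (congrFun hc ⟨a, by omega⟩) ⟨a + d, ha⟩
    rw [Matrix.sum_apply, Matrix.zero_apply] at h1
    have hne : θ (a + d) - θ a ≠ 0 := sub_ne_zero.2 fun h => by
      have := hθ _ ha _ (by omega) h
      omega
    have hW : ∏ k ∈ Finset.range d, γ (a + 1 + k) ≠ 0 := Finset.prod_ne_zero_iff.2 fun _ _ => hγ _
    refine (mul_eq_zero.1 (?_ : ((θ (a + d) - θ a) * ∏ k ∈ Finset.range d, γ (a + 1 + k)) *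
      ∑ s ∈ Finset.range (2 * p - d), c' s * completeHom θ s a d = 0)).resolve_left
      (mul_ne_zero hne hW)
    rw [← h1]
    simp only [c', Finset.sum_mul, Finset.mul_sum]
    rw [Finset.sum_comm]
    refine Finset.sum_congr rfl fun i _ => ?_
    obtain ⟨e, he⟩ : ∃ e, (i.1.1 : ℕ) = 2 * i.1.2 + e := ⟨_, (Nat.add_sub_cancel' i.2.le).symm⟩
    rw [Matrix.smul_apply, Ring.lie_def, Matrix.sub_apply, Matrix.mul_diagonal,
      Matrix.diagonal_mul, he, mixCoeff_weightedShift, smul_eq_mul]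
    by_cases hed : e = d
    · subst hed
      rw [if_pos rfl, Finset.sum_eq_single (2 * (i.1.2 : ℕ)), if_pos ⟨rfl, rfl⟩]
      · ring
      · intro s _ hs
        rw [if_neg fun h => hs h.1.symm, zero_mul, mul_zero]
      · intro h
        exact absurd (Finset.mem_range.2 (by have := i.1.1.2; omega)) h
    · rw [if_neg (by simp only; omega)]
      rw [Finset.sum_eq_zero]
      · ring
      · intro s _
        rw [if_neg (by omega), zero_mul, mul_zero])
  have h2 := hc' (2 * i₀.1.2) (by have := i₀.1.1.2; omega)
  simp only [c'] at h2
  rw [Finset.sum_eq_single i₀, if_pos ⟨rfl, hd⟩] at h2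
  · exact h2
  · intro i _ hi
    rw [if_neg]
    rintro ⟨h3, h4⟩
    exact hi (Subtype.ext (Prod.ext (Fin.ext (by omega)) (Fin.ext (by omega))))
  · simp

end WeightedShift

/-! ### An adapted eigenbasis and a complex symmetric point -/

section Spectrum

/-- The half plane used to choose one element of each pair `z, -z` of nonzero complex numbers. -/
def UpperHalf (z : ℂ) : Prop := 0 < z.re ∨ z.re = 0 ∧ 0 < z.im

theorem upperHalf_or_neg {z : ℂ} (hz : z ≠ 0) : UpperHalf z ∨ UpperHalf (-z) := by
  unfold UpperHalf
  rw [Complex.neg_re, Complex.neg_im]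
  rcases lt_trichotomy z.re 0 with h | h | h
  · exact Or.inr (Or.inl (by linarith))
  · rcases lt_trichotomy z.im 0 with h' | h' | h'
    · exact Or.inr (Or.inr ⟨by linarith, by linarith⟩)
    · exact absurd (Complex.ext h h') hz
    · exact Or.inl (Or.inr ⟨h, h'⟩)
  · exact Or.inl (Or.inl h)

theorem not_upperHalf_neg {z : ℂ} (hz : UpperHalf z) : ¬UpperHalf (-z) := by
  unfold UpperHalf at *
  rw [Complex.neg_re, Complex.neg_im]
  rintro (h | ⟨h, h'⟩) <;> rcases hz with h1 | ⟨h1, h2⟩ <;> linarith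

/-- The `p` elements in the half plane are listed first, then their negatives in reverse order. -/
theorem exists_antisymmetric_enumeration {p : ℕ} {S : Finset ℂ} (h0 : (0 : ℂ) ∉ S)
    (hneg : ∀ z ∈ S, -z ∈ S) (hcard : S.card = 2 * p) :
    ∃ θ : Fin (2 * p) → ℂ, Function.Injective θ ∧ (∀ i, θ i ∈ S) ∧ ∀ i, θ i.rev = -θ i := by
  classical
  set S' := S.filter UpperHalf with hS'
  have hmem : ∀ z ∈ S', z ∈ S ∧ UpperHalf z := fun z hz => Finset.mem_filter.1 hz
  have hcard' : S'.card = p := by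
    have h1 : S = S' ∪ S'.image Neg.neg := by
      ext z
      rw [Finset.mem_union, Finset.mem_image]
      constructor
      · intro hz
        rcases upperHalf_or_neg (fun h => h0 (h ▸ hz)) with h | h
        · exact Or.inl (Finset.mem_filter.2 ⟨hz, h⟩)
        · exact Or.inr ⟨-z, Finset.mem_filter.2 ⟨hneg z hz, h⟩, neg_neg z⟩
      · rintro (hz | ⟨w, hw, rfl⟩)
        · exact (hmem z hz).1
        · exact hneg w (hmem w hw).1
    have h2 : Disjoint S' (S'.image Neg.neg) := by
      rw [Finset.disjoint_left]
      intro z hz hz'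
      obtain ⟨w, hw, rfl⟩ := Finset.mem_image.1 hz'
      exact not_upperHalf_neg (hmem w hw).2 (hmem _ hz).2
    have h3 := congrArg Finset.card h1
    rw [Finset.card_union_of_disjoint h2, Finset.card_image_of_injective _ neg_injective] at h3
    omega
  let e : Fin p ≃ S' := (S'.equivFinOfCardEq hcard').symm
  have he : ∀ i, UpperHalf (e i) := fun i => (hmem _ (e i).2).2
  have hinj : ∀ i j, (e i : ℂ) = e j → i = j := fun i j h => e.injective (Subtype.ext h)
  refine ⟨fun i => if h : (i : ℕ) < p then e ⟨i, h⟩ else -e ⟨2 * p - 1 - i, by have := i.2; omega⟩,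
    ?_, ?_, ?_⟩
  · intro i j hij
    have hi := i.2
    have hj := j.2
    simp only at hij
    split_ifs at hij with h1 h2 h2
    · have := hinj _ _ hij
      simp only [Fin.mk.injEq] at this
      exact Fin.ext this
    · exact absurd (hij ▸ he ⟨i, h1⟩) (not_upperHalf_neg (he _))
    · exact absurd (hij ▸ he ⟨j, h2⟩) (not_upperHalf_neg (he _))
    · have := hinj _ _ (neg_injective hij)
      simp only [Fin.mk.injEq] at this
      exact Fin.ext (by omega)
  · intro i
    simp only
    split_ifs
    · exact (hmem _ (e _).2).1
    · exact hneg _ (hmem _ (e _).2).1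
  · intro i
    have hi := i.2
    simp only [Fin.val_rev]
    by_cases h : (i : ℕ) < p
    · rw [dif_pos h, dif_neg (by omega)]
      congr 4
      omega
    · rw [dif_neg h, dif_pos (by omega), neg_neg]
      congr 3
      omega

variable {n : ℕ}

theorem neg_mem_spectrum_of_skew {M : Matrix (Fin n) (Fin n) ℂ} (hM : Mᵀ = -M) {z : ℂ}
    (hz : z ∈ spectrum ℂ M) : -z ∈ spectrum ℂ M := by
  rw [spectrum.mem_iff] at hz ⊢
  intro h
  apply hz
  have e : algebraMap ℂ (Matrix (Fin n) (Fin n) ℂ) z - M =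
      -(algebraMap ℂ (Matrix (Fin n) (Fin n) ℂ) (-z) - M)ᵀ := by
    rw [Matrix.transpose_sub, hM, Algebra.algebraMap_eq_smul_one, Algebra.algebraMap_eq_smul_one,
      Matrix.transpose_smul, Matrix.transpose_one, neg_smul]
    abel
  rw [e]
  rw [Matrix.isUnit_iff_isUnit_det] at h ⊢
  rw [Matrix.det_neg, Matrix.det_transpose]
  exact (((isUnit_one.neg).pow _).mul h)

theorem exists_eigenvector {M : Matrix (Fin n) (Fin n) ℂ} {z : ℂ} (hz : z ∈ spectrum ℂ M) :
    ∃ v, Module.End.HasEigenvector (Matrix.toLin' M) z v := by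
  rw [← Matrix.spectrum_toLin', ← Module.End.hasEigenvalue_iff_mem_spectrum] at hz
  exact hz.exists_hasEigenvector

/-- A complex skew-symmetric invertible matrix with simple spectrum has an eigenbasis whose Gram
matrix is antidiagonal. -/
theorem exists_eigenbasis {p : ℕ} {M : Matrix (Fin (2 * p)) (Fin (2 * p)) ℂ} (hM : Mᵀ = -M)
    (hdet : IsUnit M.det) (hspec : (spectrum ℂ M).ncard = 2 * p) :
    ∃ (θ : Fin (2 * p) → ℂ) (P : Matrix (Fin (2 * p)) (Fin (2 * p)) ℂ),
      Function.Injective θ ∧ IsUnit P.det ∧ M * P = P * Matrix.diagonal θ ∧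
      (∀ i j, j ≠ i.rev → (Pᵀ * P) i j = 0) ∧ ∀ i, (Pᵀ * P) i.rev i ≠ 0 := by
  have hfin : (spectrum ℂ M).Finite := by
    rw [← Matrix.spectrum_toLin']
    exact Module.End.finite_spectrum _
  obtain ⟨θ, hinj, hθ, hrev⟩ := exists_antisymmetric_enumeration (p := p) (S := hfin.toFinset)
    (fun h => by
      rw [hfin.mem_toFinset, spectrum.zero_mem_iff, Matrix.isUnit_iff_isUnit_det] at h
      exact h hdet)
    (fun z hz => hfin.mem_toFinset.2 (neg_mem_spectrum_of_skew hM (hfin.mem_toFinset.1 hz)))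
    (by rw [← Set.ncard_eq_toFinset_card _ hfin, hspec])
  choose v hv using fun i => exists_eigenvector (hfin.mem_toFinset.1 (hθ i))
  set P : Matrix (Fin (2 * p)) (Fin (2 * p)) ℂ := Matrix.of fun a i => v i a with hP
  have hMP : M * P = P * Matrix.diagonal θ := by
    ext a i
    have h := congrFun (hv i).apply_eq_smul a
    rw [Matrix.toLin'_apply, Pi.smul_apply, smul_eq_mul] at h
    rw [Matrix.mul_diagonal]
    exact h.trans (mul_comm _ _)
  have hPdet : IsUnit P.det := by
    rw [← Matrix.isUnit_iff_isUnit_det, ← Matrix.linearIndependent_cols_iff_isUnit]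
    exact Module.End.eigenvectors_linearIndependent' (Matrix.toLin' M) θ hinj v hv
  -- Skewness of `M` makes the Gram matrix anticommute with the eigenvalue matrix: `(θ i + θ j) J i
  -- j = 0`, and only opposite eigenvalues pair nontrivially.
  have hJ : Matrix.diagonal θ * (Pᵀ * P) = -(Pᵀ * P * Matrix.diagonal θ) := by
    have h1 := congrArg Matrix.transpose hMP
    rw [Matrix.transpose_mul, Matrix.transpose_mul, Matrix.diagonal_transpose, hM] at h1
    rw [← Matrix.mul_assoc, ← h1, Matrix.mul_assoc, Matrix.mul_assoc, ← hMP]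
    simp only [mul_neg, neg_mul]
  have hzero : ∀ i j, j ≠ i.rev → (Pᵀ * P) i j = 0 := by
    intro i j hij
    have h := congrFun (congrFun hJ i) j
    rw [Matrix.diagonal_mul, Matrix.neg_apply, Matrix.mul_diagonal] at h
    have h2 : (θ i + θ j) * (Pᵀ * P) i j = 0 := by linear_combination h
    refine (mul_eq_zero.1 h2).resolve_left fun h3 => hij (hinj ?_)
    rw [hrev]
    linear_combination h3
  refine ⟨θ, P, hinj, hPdet, hMP, hzero, fun i hi => ?_⟩
  have hd : (Pᵀ * P).det ≠ 0 := by
    rw [Matrix.det_mul, Matrix.det_transpose]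
    exact mul_ne_zero hPdet.ne_zero hPdet.ne_zero
  -- A vanishing antidiagonal entry would kill a whole row of the invertible Gram matrix.
  refine hd (Matrix.det_eq_zero_of_row_eq_zero i.rev fun j => ?_)
  by_cases hj : j = i
  · rw [hj, hi]
  · exact hzero _ _ (by rwa [Fin.rev_rev])

theorem exists_complex_linearIndependent {p : ℕ} {M : Matrix (Fin (2 * p)) (Fin (2 * p)) ℂ}
    (hM : Mᵀ = -M) (hdet : IsUnit M.det) (hspec : (spectrum ℂ M).ncard = 2 * p) :
    ∃ Z : Matrix (Fin (2 * p)) (Fin (2 * p)) ℂ, Zᵀ = Z ∧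
      LinearIndependent ℂ fun i : Idx p => ⁅mixCoeff Z M i.1.1 (2 * i.1.2), M⁆ := by
  obtain ⟨θ, P, hinj, hPdet, hMP, hzero, hne⟩ := exists_eigenbasis hM hdet hspec
  let θ' : ℕ → ℂ := fun i => if h : i < 2 * p then θ ⟨i, h⟩ else 0
  -- The value `1` outside the range keeps every weight nonzero.
  let γ : ℕ → ℂ := fun i => if h : i < 2 * p then (Pᵀ * P) (Fin.rev ⟨i, h⟩) ⟨i, h⟩ else 1
  have hθ' : (fun i : Fin (2 * p) => θ' i) = θ := by
    funext i
    simp only [θ', dif_pos i.2]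
  have hγ : ∀ i, γ i ≠ 0 := by
    intro i
    simp only [γ]
    split_ifs
    · exact hne _
    · exact one_ne_zero
  -- Ones on `i + j = 2p - 2`, just next to the antidiagonal `i + j = 2p - 1` of the Gram matrix, so
  -- that the product has only a first superdiagonal. `Q` is symmetric, hence so is `P Q Pᵀ`.
  let Q : Matrix (Fin (2 * p)) (Fin (2 * p)) ℂ :=
    Matrix.of fun i j => if (i : ℕ) + j + 2 = 2 * p then 1 else 0
  have hQ : Qᵀ = Q := by
    ext i j
    simp only [Q, Matrix.transpose_apply, Matrix.of_apply, add_comm]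
  have hQJ : Q * (Pᵀ * P) = weightedShift (2 * p) γ := by
    ext i j
    have hi := i.2
    have hj := j.2
    rw [Matrix.mul_apply, Finset.sum_eq_single j.rev]
    · simp only [Q, weightedShift, Matrix.of_apply, Fin.val_rev, γ, dif_pos j.2, Fin.eta]
      by_cases h : (j : ℕ) = i + 1
      · rw [if_pos h, if_pos (by omega), one_mul]
      · rw [if_neg h, if_neg (by omega), zero_mul]
    · intro k _ hk
      rw [hzero k j (fun h => hk (by rw [h, Fin.rev_rev])), mul_zero]
    · simp
  set Z := P * Q * Pᵀ with hZ
  have hZP : Z * P = P * weightedShift (2 * p) γ := by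
    rw [← hQJ, hZ]
    simp only [Matrix.mul_assoc]
  refine ⟨Z, ?_, ?_⟩
  · rw [hZ, Matrix.transpose_mul, Matrix.transpose_mul, Matrix.transpose_transpose, hQ,
      Matrix.mul_assoc]
  have hli := linearIndependent_weightedShift (p := p) θ' γ hγ (by
    intro i hi j hj h
    simp only [θ', dif_pos hi, dif_pos hj] at h
    simpa using hinj h)
  rw [hθ'] at hli
  rw [Fintype.linearIndependent_iff] at hli ⊢
  intro c hc
  apply hli
  have h1 := congrArg (· * P) hc
  simp only [Finset.sum_mul, zero_mul] at h1
  have h2 : ∀ i : Idx p, (c i • ⁅mixCoeff Z M i.1.1 (2 * i.1.2), M⁆) * P =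
      P * (c i • ⁅mixCoeff (weightedShift (2 * p) γ) (Matrix.diagonal θ) i.1.1 (2 * i.1.2),
        Matrix.diagonal θ⁆) := by
    intro i
    have h3 := mixCoeff_mul_of_semiconj hZP hMP i.1.1 (2 * i.1.2)
    rw [smul_mul_assoc, mul_smul_comm, Ring.lie_def, Ring.lie_def, sub_mul, mul_sub,
      Matrix.mul_assoc _ M, hMP, Matrix.mul_assoc M, h3, ← Matrix.mul_assoc, h3, ← Matrix.mul_assoc,
      hMP]
    simp only [Matrix.mul_assoc]
  rw [Finset.sum_congr rfl fun i _ => h2 i, ← Finset.mul_sum] at h1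
  have h4 := congrArg (P⁻¹ * ·) h1
  simpa only [Matrix.nonsing_inv_mul_cancel_left _ _ hPdet, mul_zero] using h4

end Spectrum

/-! ### From a complex to a real point -/

section RealPoint

variable {p : ℕ} {N : Skew (2 * p)}

theorem linearIndependent_flowVec_of_complex {X : Sym (2 * p)}
    (h : LinearIndependent ℂ fun i : Idx p =>
      ⁅mixCoeff (X.1.map Complex.ofReal) (N.1.map Complex.ofReal) i.1.1 (2 * i.1.2),
        N.1.map Complex.ofReal⁆) :
    LinearIndependent ℝ (flowVec N X) := by
  rw [Fintype.linearIndependent_iff] at h ⊢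
  intro c hc i
  have h1 := congrArg Subtype.val hc
  rw [AddSubmonoidClass.coe_finsetSum] at h1
  have h2 := congrArg (Complex.ofRealHom.mapMatrix) h1
  rw [map_sum] at h2
  have h3 := h (fun i => (c i : ℂ)) (by
    refine Eq.trans (Finset.sum_congr rfl fun i _ => ?_) (h2.trans (map_zero _))
    change _ = (c i • ⁅mixCoeff X.1 N.1 i.1.1 (2 * i.1.2), N.1⁆).map Complex.ofRealHom
    have h4 := mixCoeff_map X.1 N.1 Complex.ofRealHom i.1.1 (2 * i.1.2)
    have h5 : (⁅mixCoeff X.1 N.1 i.1.1 (2 * i.1.2), N.1⁆).map Complex.ofRealHom =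
        ⁅(mixCoeff X.1 N.1 i.1.1 (2 * i.1.2)).map Complex.ofRealHom,
          N.1.map Complex.ofRealHom⁆ := by
      rw [Ring.lie_def, Ring.lie_def, Matrix.map_sub _ (map_sub _), Matrix.map_mul, Matrix.map_mul]
    rw [← h4] at h5
    ext a b
    have h6 := congrFun (congrFun h5 a) b
    rw [Matrix.map_apply] at h6
    rw [Matrix.map_apply, Matrix.smul_apply, Matrix.smul_apply, smul_eq_mul, smul_eq_mul, map_mul,
      h6]
    rfl) i
  exact Complex.ofReal_eq_zero.1 h3

/-- The family `Re Z + s Im Z` is analytic in complex `s`, equals `Z` at `s = i`, and is real for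
real `s`; independence at `i` persists at some small real `s`. -/
theorem exists_linearIndependent_flowVec (hinv : IsUnit N.1.det) (hdist : DistinctEigenvalues N) :
    ∃ X : Sym (2 * p), LinearIndependent ℝ (flowVec N X) := by
  obtain ⟨Z, hZ, hli⟩ := exists_complex_linearIndependent (p := p) (M := N.1.map Complex.ofReal)
    (by
      rw [← Matrix.transpose_map, skew_transpose]
      ext a b
      simp)
    (by
      have := hinv.map Complex.ofRealHom
      rwa [RingHom.map_det] at this) hdist
  let A : Sym (2 * p) := ⟨Z.map Complex.re, by
    change (_)ᵀ = _
    rw [← Matrix.transpose_map, hZ]⟩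
  let B : Sym (2 * p) := ⟨Z.map Complex.im, by
    change (_)ᵀ = _
    rw [← Matrix.transpose_map, hZ]⟩
  let f : ℂ → Matrix (Fin (2 * p)) (Fin (2 * p)) ℂ := fun s =>
    A.1.map Complex.ofReal + s • B.1.map Complex.ofReal
  have hf : EntryAnalytic f := (EntryAnalytic.const _).add (EntryAnalytic.id_smul _)
  have hI : f Complex.I = Z := by
    ext a b
    simp only [f, A, B, Matrix.add_apply, Matrix.smul_apply, Matrix.map_apply, smul_eq_mul]
    rw [mul_comm, Complex.re_add_im]
  have hev := eventually_linearIndependent (s₁ := Complex.I)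
    (w := fun (i : Idx p) s =>
      ⁅mixCoeff (f s) (N.1.map Complex.ofReal) i.1.1 (2 * i.1.2), N.1.map Complex.ofReal⁆)
    (fun i => (hf.mixCoeff _ _ _).lie_const _) (by rw [hI]; exact hli) 0
  have htend : Filter.Tendsto Complex.ofReal (nhdsWithin 0 {0}ᶜ) (nhdsWithin 0 {0}ᶜ) := by
    refine tendsto_nhdsWithin_of_tendsto_nhds_of_eventually_within _ ?_ ?_
    · exact (Complex.continuous_ofReal.tendsto' 0 0 Complex.ofReal_zero).mono_left nhdsWithin_le_nhds
    · filter_upwards [self_mem_nhdsWithin] with t ht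
      exact Complex.ofReal_ne_zero.2 ht
  obtain ⟨t, ht⟩ := (htend.eventually hev).exists
  refine ⟨A + t • B, linearIndependent_flowVec_of_complex ?_⟩
  have e : (A + t • B).1.map Complex.ofReal = f t := by
    ext a b
    simp [f]
  rw [e]
  exact ht

end RealPoint

/-! ### Local solutions of a linear matrix equation -/

section LinearODE

open Set Metric

variable {R : Type*} [NormedRing R] [NormedAlgebra ℝ R] [CompleteSpace R]

theorem exists_local_fundamental_solution {A : ℝ → R} (hA : Continuous A) (t₀ : ℝ) :
    ∃ ε > 0, ∃ h : ℝ → R, h t₀ = 1 ∧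
      ∀ t ∈ Ioo (t₀ - ε) (t₀ + ε), HasDerivAt h (h t * A t) t := by
  obtain ⟨C, hC⟩ := (isCompact_Icc (a := t₀ - 1) (b := t₀ + 1)).exists_bound_of_continuousOn
    hA.continuousOn
  have hC0 : 0 ≤ C := (norm_nonneg _).trans (hC t₀ ⟨by linarith, by linarith⟩)
  let K : NNReal := ⟨C, hC0⟩
  let L : NNReal := (‖(1 : R)‖₊ + 1) * K
  -- `L` bounds the speed on the unit ball about `1`; since `L ε ≤ 1`, solutions stay in that ball.
  let ε : ℝ := min 1 (1 / (L + 1))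
  have hL : (0 : ℝ) < L + 1 := add_pos_of_nonneg_of_pos L.2 one_pos
  have hε : 0 < ε := lt_min one_pos (by positivity)
  have hε1 : ε ≤ 1 := min_le_left _ _
  have hAt : ∀ t ∈ Icc (t₀ - ε) (t₀ + ε), ‖A t‖ ≤ C := fun t ht =>
    hC t ⟨by linarith [ht.1], by linarith [ht.2]⟩
  have hPL : IsPicardLindelof (fun t h => h * A t) (tmin := t₀ - ε) (tmax := t₀ + ε)
      ⟨t₀, by constructor <;> linarith⟩ (1 : R) 1 0 L K :=
    { lipschitzOnWith := fun t ht => LipschitzOnWith.of_dist_le_mul fun x _ y _ => by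
        rw [dist_eq_norm, dist_eq_norm, ← sub_mul, mul_comm]
        exact (norm_mul_le _ _).trans (mul_le_mul_of_nonneg_left (hAt t ht) (norm_nonneg _))
      continuousOn := fun x _ => (continuous_const.mul hA).continuousOn
      norm_le := fun t ht x hx => by
        refine (norm_mul_le _ _).trans ?_
        change ‖x‖ * ‖A t‖ ≤ (‖(1 : R)‖ + 1) * C
        have hx' : ‖x‖ ≤ ‖(1 : R)‖ + 1 := norm_le_of_mem_closedBall hx
        exact mul_le_mul hx' (hAt t ht) (norm_nonneg _) (by positivity)
      mul_max_le := by
        simp only [add_sub_cancel_left, sub_sub_cancel, max_self]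
        have h1 : ε ≤ 1 / (L + 1) := min_le_right _ _
        have h2 : (L : ℝ) * ε ≤ L * (1 / (L + 1)) := mul_le_mul_of_nonneg_left h1 L.2
        refine h2.trans ?_
        rw [mul_one_div, NNReal.coe_one, NNReal.coe_zero, sub_zero, div_le_one hL]
        linarith }
  obtain ⟨h, h0, hh⟩ := hPL.exists_eq_forall_mem_Icc_hasDerivWithinAt₀
  exact ⟨ε, hε, h, h0, fun t ht =>
    (hh t (Ioo_subset_Icc_self ht)).hasDerivAt (Icc_mem_nhds ht.1 ht.2)⟩

end LinearODE

/-! ### Products of exponentials in the symplectic group -/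

section Leaf

open scoped Matrix.Norms.Operator
open Filter Topology

variable {n : ℕ}

theorem hasDerivAt_transpose {f : ℝ → Matrix (Fin n) (Fin n) ℝ} {f' : Matrix (Fin n) (Fin n) ℝ}
    {t : ℝ} (h : HasDerivAt f f' t) : HasDerivAt (fun t => (f t)ᵀ) f'ᵀ t :=
  (Matrix.transposeLinearEquiv (Fin n) (Fin n) ℝ ℝ).toLinearMap.toContinuousLinearMap.hasFDerivAt.comp_hasDerivAt
    t h

theorem symPart_coe (X : Sym n) : symPart n X.1 = X := Subtype.ext <| by
  change (1 / 2 : ℝ) • (X.1 + X.1ᵀ) = X.1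
  rw [(X.2 : X.1ᵀ = X.1), ← two_smul ℝ, smul_smul]
  norm_num

theorem hasDerivAt_sym {γ : ℝ → Sym n} {v : Sym n} {t : ℝ}
    (h : HasDerivAt (fun t => (γ t).1) v.1 t) : HasDerivAt γ v t := by
  have h1 := (symPart n).toContinuousLinearMap.hasFDerivAt.comp_hasDerivAt t h
  have h2 : (symPart n).toContinuousLinearMap ∘ (fun t => (γ t).1) = γ :=
    funext fun t => symPart_coe (γ t)
  rw [h2] at h1
  exact h1.congr_deriv (symPart_coe v)

theorem hasDerivAt_coe_sym {γ : ℝ → Sym n} {v : Sym n} {t : ℝ} (h : HasDerivAt γ v t) :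
    HasDerivAt (fun t => (γ t).1) v.1 t :=
  (symSubmodule n).subtypeL.hasFDerivAt.comp_hasDerivAt t h

theorem hasDerivAt_of_entries {f : ℝ → Matrix (Fin n) (Fin n) ℝ} {f' : Matrix (Fin n) (Fin n) ℝ}
    {t : ℝ} (h : ∀ i j, HasDerivAt (fun t => f t i j) (f' i j) t) : HasDerivAt f f' t :=
  hasDerivAt_pi.2 fun i => hasDerivAt_pi.2 fun j => h i j

theorem entryAnalytic_of_analyticAt {f : ℝ → Matrix (Fin n) (Fin n) ℝ}
    (h : ∀ s, AnalyticAt ℝ f s) : EntryAnalytic f := fun a b s =>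
  ((Matrix.entryLinearMap ℝ ℝ a b).toContinuousLinearMap.analyticAt _).comp (h s)

variable (N : Skew n)

/-- The product of the one-parameter groups `exp (s α N)`, `α ∈ l`. -/
def flowWord (l : List (Sym n)) (s : ℝ) : Matrix (Fin n) (Fin n) ℝ :=
  (l.map fun α => NormedSpace.exp (s • (α.1 * N.1))).prod

theorem entryAnalytic_flowWord (l : List (Sym n)) : EntryAnalytic (flowWord N l) := by
  induction l with
  | nil => exact EntryAnalytic.const 1
  | cons α l ih =>
    have h : EntryAnalytic fun s : ℝ => NormedSpace.exp (s • (α.1 * N.1)) := by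
      refine entryAnalytic_of_analyticAt fun s => ?_
      have h1 : AnalyticAt ℝ (fun s : ℝ => s • (α.1 * N.1)) s := analyticAt_id.smul analyticAt_const
      exact (NormedSpace.exp_analytic (𝕂 := ℝ) _).comp h1
    exact h.mul ih

theorem flowWord_zero (l : List (Sym n)) : flowWord N l 0 = 1 := by
  induction l with
  | nil => rfl
  | cons α l ih =>
    rw [flowWord, List.map_cons, List.prod_cons, zero_smul, NormedSpace.exp_zero, one_mul]
    exact ih

theorem flowWord_append (l l' : List (Sym n)) (s : ℝ) :
    flowWord N (l ++ l') s = flowWord N l s * flowWord N l' s := by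
  rw [flowWord, List.map_append, List.prod_append]
  rfl

theorem flowWord_smul (l : List (Sym n)) (t s : ℝ) :
    flowWord N (l.map fun α => t • α) s = flowWord N l (s * t) := by
  rw [flowWord, flowWord, List.map_map]
  congr 2
  funext α
  simp only [Function.comp_apply]
  congr 1
  change s • (t • α.1 * N.1) = _
  rw [smul_mul_assoc, smul_smul]

variable {N}

/-- `(αN)ᵀ = N (-αN) N⁻¹`, so the transposed exponential is the conjugate by `N` of the inverse
exponential. -/
theorem exp_symplectic (hinv : IsUnit N.1.det) (α : Sym n) :
    NormedSpace.exp (α.1 * N.1) * N.1⁻¹ * (NormedSpace.exp (α.1 * N.1))ᵀ = N.1⁻¹ := by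
  have hU : IsUnit N.1 := (Matrix.isUnit_iff_isUnit_det _).2 hinv
  have h1 : (α.1 * N.1)ᵀ = N.1 * -(α.1 * N.1) * N.1⁻¹ := by
    rw [Matrix.transpose_mul, (α.2 : α.1ᵀ = α.1), skew_transpose, mul_neg, neg_mul, neg_mul,
      ← Matrix.mul_assoc, Matrix.mul_nonsing_inv_cancel_right _ _ hinv]
  have hE : IsUnit (NormedSpace.exp (α.1 * N.1)).det :=
    (Matrix.isUnit_iff_isUnit_det _).1 (Matrix.isUnit_exp _)
  rw [← Matrix.exp_transpose, h1, Matrix.exp_conj _ _ hU, Matrix.exp_neg, Matrix.mul_assoc,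
    Matrix.mul_assoc, Matrix.nonsing_inv_mul_cancel_left _ _ hinv, ← Matrix.mul_assoc,
    Matrix.mul_nonsing_inv _ hE, Matrix.one_mul]

theorem flowWord_symplectic (hinv : IsUnit N.1.det) (l : List (Sym n)) (s : ℝ) :
    flowWord N l s * N.1⁻¹ * (flowWord N l s)ᵀ = N.1⁻¹ := by
  induction l with
  | nil => simp [flowWord]
  | cons α l ih =>
    have h := exp_symplectic hinv (s • α)
    have e : (s • α).1 * N.1 = s • (α.1 * N.1) := smul_mul_assoc _ _ _
    rw [e] at h
    change NormedSpace.exp (s • (α.1 * N.1)) * flowWord N l s * N.1⁻¹ *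
      (NormedSpace.exp (s • (α.1 * N.1)) * flowWord N l s)ᵀ = _
    have h1 : NormedSpace.exp (s • (α.1 * N.1)) * flowWord N l s * N.1⁻¹ *
        (NormedSpace.exp (s • (α.1 * N.1)) * flowWord N l s)ᵀ =
        NormedSpace.exp (s • (α.1 * N.1)) * (flowWord N l s * N.1⁻¹ * (flowWord N l s)ᵀ) *
          (NormedSpace.exp (s • (α.1 * N.1)))ᵀ := by
      rw [Matrix.transpose_mul]
      simp only [Matrix.mul_assoc]
    rw [h1, ih, h]

end Leaf

/-! ### Symplectic leaves as congruence orbits -/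

section Leaf

open scoped Matrix.Norms.Operator
open Filter Topology

variable {n : ℕ} {N : Skew n}

/-- The congruence `Z ↦ kᵀ Z k` on `Sym(n)`. -/
def congruence (k : Matrix (Fin n) (Fin n) ℝ) (Z : Sym n) : Sym n :=
  ⟨kᵀ * Z.1 * k, by
    change (_)ᵀ = _
    rw [Matrix.transpose_mul, Matrix.transpose_mul, Matrix.transpose_transpose,
      (Z.2 : Z.1ᵀ = Z.1), Matrix.mul_assoc]⟩

theorem congruence_one (Z : Sym n) : congruence 1 Z = Z := Subtype.ext <| by
  change 1ᵀ * Z.1 * 1 = Z.1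
  rw [Matrix.transpose_one, Matrix.one_mul, Matrix.mul_one]

theorem congruence_mul (k l : Matrix (Fin n) (Fin n) ℝ) (Z : Sym n) :
    congruence (k * l) Z = congruence l (congruence k Z) := Subtype.ext <| by
  change (k * l)ᵀ * Z.1 * (k * l) = lᵀ * (kᵀ * Z.1 * k) * l
  rw [Matrix.transpose_mul]
  simp only [Matrix.mul_assoc]

theorem inv_of_symplectic (hinv : IsUnit N.1.det) {k : Matrix (Fin n) (Fin n) ℝ}
    (hk : k * N.1⁻¹ * kᵀ = N.1⁻¹) :
    k * (N.1⁻¹ * kᵀ * N.1) = 1 ∧ N.1⁻¹ * kᵀ * N.1 * k = 1 := by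
  have h : k * (N.1⁻¹ * kᵀ * N.1) = 1 := by
    rw [← Matrix.mul_assoc, ← Matrix.mul_assoc, hk, Matrix.nonsing_inv_mul _ hinv]
  exact ⟨h, mul_eq_one_comm.1 h⟩

/-- A differentiable path in the symplectic group starting at `1` moves `X` inside its leaf. -/
theorem congruence_mem_symplecticLeaf (hinv : IsUnit N.1.det) {k k' : ℝ → Matrix (Fin n) (Fin n) ℝ}
    (hk : ∀ s, HasDerivAt k (k' s) s) (hk' : Continuous k')
    (hsp : ∀ s, k s * N.1⁻¹ * (k s)ᵀ = N.1⁻¹) (h0 : k 0 = 1) (X : Sym n) :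
    congruence (k 1) X ∈ symplecticLeaf N X := by
  have hkc : Continuous k := continuous_iff_continuousAt.2 fun s => (hk s).continuousAt
  let g : ℝ → Matrix (Fin n) (Fin n) ℝ := fun s => N.1⁻¹ * (k s)ᵀ * N.1
  have hg : ∀ s, k s * g s = 1 ∧ g s * k s = 1 := fun s => inv_of_symplectic hinv (hsp s)
  have hgt : ∀ s, (g s)ᵀ * (k s)ᵀ = 1 ∧ (k s)ᵀ * (g s)ᵀ = 1 := fun s => by
    rw [← Matrix.transpose_mul, ← Matrix.transpose_mul, (hg s).1, (hg s).2, Matrix.transpose_one]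
    exact ⟨rfl, rfl⟩
  have hNt := transpose_inv_skew N
  -- Differentiating `k N⁻¹ kᵀ = N⁻¹` shows that `k⁻¹ k' N⁻¹` is symmetric; it serves as the
  -- covector `α` driving the curve.
  have hbeta : ∀ s, (g s * k' s * N.1⁻¹)ᵀ = g s * k' s * N.1⁻¹ := by
    intro s
    have h1 := (((hk s).mul_const N.1⁻¹).mul (hasDerivAt_transpose (hk s)))
    have h2 : (fun s => k s * N.1⁻¹) * (fun s => (k s)ᵀ) = fun _ => N.1⁻¹ := funext hsp
    rw [h2] at h1
    have h3 := h1.unique (hasDerivAt_const s _)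
    have h4 := congrArg (fun M => g s * M * (g s)ᵀ) h3
    have e : g s * (k' s * N.1⁻¹ * (k s)ᵀ + k s * N.1⁻¹ * (k' s)ᵀ) * (g s)ᵀ =
        g s * k' s * N.1⁻¹ * ((k s)ᵀ * (g s)ᵀ) + g s * k s * N.1⁻¹ * ((k' s)ᵀ * (g s)ᵀ) := by
      noncomm_ring
    simp only [mul_zero, zero_mul] at h4
    rw [e, (hgt s).2, (hg s).2, Matrix.mul_one, Matrix.one_mul] at h4
    rw [Matrix.transpose_mul, Matrix.transpose_mul, hNt, neg_mul, eq_comm, eq_neg_iff_add_eq_zero]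
    exact h4
  refine ⟨fun s => congruence (k s) X, fun s => ⟨g s * k' s * N.1⁻¹, hbeta s⟩, ?_, ?_, rfl, ?_⟩
  · refine Continuous.subtype_mk ?_ _
    have hgc : Continuous g :=
      (continuous_const.mul (Continuous.matrix_transpose hkc)).mul continuous_const
    exact (hgc.mul hk').mul continuous_const
  · simp only [h0, congruence_one]
  · intro s
    apply hasDerivAt_sym
    have h1 := ((hasDerivAt_transpose (hk s)).mul_const X.1).mul (hk s)
    refine HasDerivAt.congr_deriv (f' := (k' s)ᵀ * X.1 * k s + (k s)ᵀ * X.1 * k' s) h1 ?_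
    change _ = (k s)ᵀ * X.1 * k s * (g s * k' s * N.1⁻¹) * N.1 -
      N.1 * (g s * k' s * N.1⁻¹) * ((k s)ᵀ * X.1 * k s)
    have e1 : (k s)ᵀ * X.1 * k s * (g s * k' s * N.1⁻¹) * N.1 =
        (k s)ᵀ * X.1 * (k s * g s) * k' s * (N.1⁻¹ * N.1) := by noncomm_ring
    have e2 : N.1 * (g s * k' s * N.1⁻¹) * ((k s)ᵀ * X.1 * k s) =
        -((k' s)ᵀ * ((g s)ᵀ * (k s)ᵀ) * X.1 * k s) := by
      rw [← hbeta s, Matrix.transpose_mul, Matrix.transpose_mul, hNt]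
      rw [neg_mul, mul_neg, neg_mul, Matrix.mul_nonsing_inv_cancel_left _ _ hinv]
      simp only [Matrix.mul_assoc]
    rw [e1, e2, (hg s).1, (hgt s).1, Matrix.nonsing_inv_mul _ hinv, Matrix.mul_one, Matrix.mul_one,
      Matrix.mul_one, sub_neg_eq_add, add_comm]

theorem EntryAnalytic.exists_hasDerivAt {k : ℝ → Matrix (Fin n) (Fin n) ℝ} (hk : EntryAnalytic k) :
    ∃ k' : ℝ → Matrix (Fin n) (Fin n) ℝ, Continuous k' ∧ ∀ s, HasDerivAt k (k' s) s := by
  refine ⟨fun s => Matrix.of fun i j => deriv (fun u => k u i j) s, ?_, fun s => ?_⟩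
  · refine continuous_matrix fun i j => ?_
    exact continuous_iff_continuousAt.2 fun s => (hk i j s).deriv.continuousAt
  · exact hasDerivAt_of_entries fun i j => (hk i j s).differentiableAt.hasDerivAt

/-- Scaling all the exponents by `s` lets the path reach the parameter `s` at time `1`. -/
theorem congruence_flowWord_mem_symplecticLeaf (hinv : IsUnit N.1.det) (l : List (Sym n)) (s : ℝ)
    (X : Sym n) : congruence (flowWord N l s) X ∈ symplecticLeaf N X := by
  obtain ⟨k', hk'c, hk'⟩ := (entryAnalytic_flowWord N (l.map fun α => s • α)).exists_hasDerivAt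
  have h := congruence_mem_symplecticLeaf hinv hk' hk'c (flowWord_symplectic hinv _)
    (flowWord_zero N _) X
  rwa [flowWord_smul, one_mul] at h

/-- Symplectic matrices near `1` are exponentials of elements of the symplectic Lie algebra. -/
theorem eventually_exists_exp_eq (hinv : IsUnit N.1.det) :
    ∀ᶠ h : Matrix (Fin n) (Fin n) ℝ in 𝓝 1, h * N.1⁻¹ * hᵀ = N.1⁻¹ →
      ∃ β : Sym n, NormedSpace.exp (β.1 * N.1) = h := by
  have hU : IsUnit N.1 := (Matrix.isUnit_iff_isUnit_det _).2 hinv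
  have hexp : HasStrictFDerivAt (NormedSpace.exp : Matrix (Fin n) (Fin n) ℝ → _)
      ((ContinuousLinearEquiv.refl ℝ (Matrix (Fin n) (Fin n) ℝ) :
        Matrix (Fin n) (Fin n) ℝ ≃L[ℝ] Matrix (Fin n) (Fin n) ℝ) :
        Matrix (Fin n) (Fin n) ℝ →L[ℝ] Matrix (Fin n) (Fin n) ℝ) 0 :=
    hasStrictFDerivAt_exp_zero (𝕂 := ℝ)
  obtain ⟨ℓ, hr, hl, ht⟩ : ∃ ℓ : Matrix (Fin n) (Fin n) ℝ → Matrix (Fin n) (Fin n) ℝ,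
      (∀ᶠ h in 𝓝 1, NormedSpace.exp (ℓ h) = h) ∧ (∀ᶠ B in 𝓝 0, ℓ (NormedSpace.exp B) = B) ∧
        Tendsto ℓ (𝓝 1) (𝓝 0) := by
    have hr := hexp.eventually_right_inverse
    have ht := hexp.localInverse_tendsto
    rw [NormedSpace.exp_zero] at hr ht
    exact ⟨_, hr, hexp.eventually_left_inverse, ht⟩
  have c1 : Continuous fun B : Matrix (Fin n) (Fin n) ℝ => -B := continuous_neg
  have c2 : Continuous fun B : Matrix (Fin n) (Fin n) ℝ => N.1⁻¹ * Bᵀ * N.1 :=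
    (continuous_const.mul (Continuous.matrix_transpose continuous_id)).mul continuous_const
  have t1 : Tendsto (fun h => -ℓ h) (𝓝 1) (𝓝 0) := (c1.tendsto' 0 0 neg_zero).comp ht
  have t2 : Tendsto (fun h => N.1⁻¹ * (ℓ h)ᵀ * N.1) (𝓝 1) (𝓝 0) :=
    (c2.tendsto' 0 0 (by simp)).comp ht
  filter_upwards [hr, t1.eventually hl, t2.eventually hl] with h h1 h2 h3 hsp
  -- Both exponents exponentiate to `h⁻¹` and both are near `0`, where the exponential is injective.
  -- Their equality says that `ℓ h * N⁻¹` is symmetric.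
  have h4 : NormedSpace.exp (-ℓ h) = NormedSpace.exp (N.1⁻¹ * (ℓ h)ᵀ * N.1) := by
    rw [Matrix.exp_neg, Matrix.exp_conj' _ _ hU, Matrix.exp_transpose, h1]
    exact Matrix.inv_eq_right_inv (inv_of_symplectic hinv hsp).1
  have h5 : -ℓ h = N.1⁻¹ * (ℓ h)ᵀ * N.1 := by
    rw [← h2, ← h3, h4]
  refine ⟨⟨ℓ h * N.1⁻¹, ?_⟩, ?_⟩
  · change (_)ᵀ = _
    have h6 := congrArg (· * N.1⁻¹) h5
    simp only [neg_mul, Matrix.mul_nonsing_inv_cancel_right _ _ hinv] at h6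
    rw [Matrix.transpose_mul, transpose_inv_skew, neg_mul, ← h6, neg_neg]
  · change NormedSpace.exp (ℓ h * N.1⁻¹ * N.1) = h
    rw [Matrix.nonsing_inv_mul_cancel_right _ _ hinv, h1]

/-- Solve `h' = h αN` with `h(t₀) = 1`. Then `h` is symplectic, and `γ` pulled back by `h⁻¹` has
zero derivative, so `γ(t) = hᵀ γ(t₀) h`; near `t₀` the matrix `h` is an exponential. -/
theorem eventually_exists_congruence (hinv : IsUnit N.1.det) {γ α : ℝ → Sym n} (hα : Continuous α)
    (hγ : ∀ t, HasDerivAt γ (poissonTensor N (γ t) (α t)) t) (t₀ : ℝ) :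
    ∀ᶠ t in 𝓝 t₀, ∃ β : Sym n, γ t = congruence (NormedSpace.exp (β.1 * N.1)) (γ t₀) := by
  let A : ℝ → Matrix (Fin n) (Fin n) ℝ := fun t => (α t).1 * N.1
  have hA : Continuous A := (continuous_subtype_val.comp hα).mul continuous_const
  have hNt := transpose_inv_skew N
  have hAt : ∀ t, (A t)ᵀ = -(N.1 * (α t).1) := fun t => by
    change ((α t).1 * N.1)ᵀ = _
    rw [Matrix.transpose_mul, skew_transpose, ((α t).2 : (α t).1ᵀ = (α t).1), neg_mul]
  obtain ⟨ε, hε, h, h0, hh⟩ := exists_local_fundamental_solution hA t₀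
  have hmem : t₀ ∈ Set.Ioo (t₀ - ε) (t₀ + ε) := ⟨by linarith, by linarith⟩
  have hconst : ∀ {f : ℝ → Matrix (Fin n) (Fin n) ℝ},
      (∀ t ∈ Set.Ioo (t₀ - ε) (t₀ + ε), HasDerivAt f 0 t) →
      ∀ t ∈ Set.Ioo (t₀ - ε) (t₀ + ε), f t = f t₀ := fun hf t ht =>
    isOpen_Ioo.is_const_of_deriv_eq_zero isPreconnected_Ioo
      (fun s hs => (hf s hs).differentiableAt.differentiableWithinAt)
      (fun s hs => (hf s hs).deriv) ht hmem
  have hsp : ∀ t ∈ Set.Ioo (t₀ - ε) (t₀ + ε), h t * N.1⁻¹ * (h t)ᵀ = N.1⁻¹ := by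
    intro t ht
    have := hconst (f := fun t => h t * N.1⁻¹ * (h t)ᵀ) (fun t ht => by
      refine (((hh t ht).mul_const N.1⁻¹).mul (hasDerivAt_transpose (hh t ht))).congr_deriv ?_
      rw [Matrix.transpose_mul, hAt]
      have e1 : h t * A t * N.1⁻¹ * (h t)ᵀ = h t * ((α t).1 * (N.1 * N.1⁻¹)) * (h t)ᵀ := by
        simp only [A, Matrix.mul_assoc]
      have e2 : h t * N.1⁻¹ * (-(N.1 * (α t).1) * (h t)ᵀ) =
          -(h t * (N.1⁻¹ * N.1 * (α t).1) * (h t)ᵀ) := by noncomm_ring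
      rw [e1, e2, Matrix.mul_nonsing_inv _ hinv, Matrix.nonsing_inv_mul _ hinv, Matrix.mul_one,
        Matrix.one_mul, add_neg_cancel]) t ht
    simpa [h0] using this
  let g : ℝ → Matrix (Fin n) (Fin n) ℝ := fun t => N.1⁻¹ * (h t)ᵀ * N.1
  have hg : ∀ t ∈ Set.Ioo (t₀ - ε) (t₀ + ε), HasDerivAt g (-(A t * g t)) t := by
    intro t ht
    refine (((hasDerivAt_transpose (hh t ht)).const_mul N.1⁻¹).mul_const N.1).congr_deriv ?_
    rw [Matrix.transpose_mul, hAt, neg_mul, mul_neg, neg_mul]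
    have e1 : N.1⁻¹ * (N.1 * (α t).1 * (h t)ᵀ) * N.1 = (N.1⁻¹ * N.1) * (α t).1 * (h t)ᵀ * N.1 := by
      simp only [Matrix.mul_assoc]
    have e2 : A t * g t = (α t).1 * (N.1 * N.1⁻¹) * (h t)ᵀ * N.1 := by
      simp only [A, g, Matrix.mul_assoc]
    rw [e1, e2, Matrix.mul_nonsing_inv _ hinv, Matrix.nonsing_inv_mul _ hinv, Matrix.mul_one,
      Matrix.one_mul]
  have hback : ∀ t ∈ Set.Ioo (t₀ - ε) (t₀ + ε), (g t)ᵀ * (γ t).1 * g t = (γ t₀).1 := by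
    intro t ht
    have := hconst (f := fun t => (g t)ᵀ * (γ t).1 * g t) (fun t ht => by
      refine (((hasDerivAt_transpose (hg t ht)).mul (hasDerivAt_coe_sym (hγ t))).mul
        (hg t ht)).congr_deriv ?_
      change (((-(A t * g t))ᵀ * (γ t).1 + (g t)ᵀ * ((γ t).1 * (α t).1 * N.1 -
        N.1 * (α t).1 * (γ t).1)) * g t + (g t)ᵀ * (γ t).1 * -(A t * g t)) = 0
      rw [Matrix.transpose_neg, Matrix.transpose_mul, hAt]
      simp only [A]
      noncomm_ring) t ht
    rw [this]
    simp only [g, h0, Matrix.transpose_one, Matrix.mul_one, Matrix.nonsing_inv_mul _ hinv,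
      Matrix.one_mul]
  have hhc : Tendsto h (𝓝 t₀) (𝓝 1) := by
    have := (hh t₀ hmem).continuousAt.tendsto
    rwa [h0] at this
  filter_upwards [hhc.eventually (eventually_exists_exp_eq hinv), Ioo_mem_nhds hmem.1 hmem.2]
    with t h1 ht
  obtain ⟨β, hβ⟩ := h1 (hsp t ht)
  refine ⟨β, Subtype.ext ?_⟩
  rw [hβ]
  change _ = (h t)ᵀ * (γ t₀).1 * h t
  have hgh : g t * h t = 1 := (inv_of_symplectic hinv (hsp t ht)).2
  have hgh' : (h t)ᵀ * (g t)ᵀ = 1 := by rw [← Matrix.transpose_mul, hgh, Matrix.transpose_one]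
  rw [← hback t ht]
  have e : (h t)ᵀ * ((g t)ᵀ * (γ t).1 * g t) * h t =
      ((h t)ᵀ * (g t)ᵀ) * (γ t).1 * (g t * h t) := by noncomm_ring
  rw [e, hgh, hgh', Matrix.one_mul, Matrix.mul_one]

/-- Being joined by a word is transitive and holds locally in both directions along the curve, so
connectedness of the line makes it global. -/
theorem exists_flowWord_of_mem_symplecticLeaf (hinv : IsUnit N.1.det) {X Y : Sym n}
    (hY : Y ∈ symplecticLeaf N X) : ∃ l : List (Sym n), Y = congruence (flowWord N l 1) X := by
  obtain ⟨γ, α, hα, rfl, rfl, hγ⟩ := hY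
  have hsingle : ∀ β : Sym n, flowWord N [β] 1 = NormedSpace.exp (β.1 * N.1) := fun β => by
    simp [flowWord]
  refine PreconnectedSpace.induction₂' (α := ℝ)
    (fun s t => ∃ l : List (Sym n), γ t = congruence (flowWord N l 1) (γ s)) (fun t₀ => ?_)
    ⟨?_⟩ 0 1
  · filter_upwards [eventually_exists_congruence hinv hα hγ t₀] with t ht
    obtain ⟨β, hβ⟩ := ht
    refine ⟨⟨[β], by rw [hsingle, hβ]⟩, ⟨[-β], ?_⟩⟩
    have e : (-β).1 * N.1 = -(β.1 * N.1) := neg_mul _ _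
    have hE : IsUnit (NormedSpace.exp (β.1 * N.1)).det :=
      (Matrix.isUnit_iff_isUnit_det _).1 (Matrix.isUnit_exp _)
    rw [hsingle, hβ, ← congruence_mul, e, Matrix.exp_neg, Matrix.mul_nonsing_inv _ hE,
      congruence_one]
  · rintro r s t ⟨l, hl⟩ ⟨l', hl'⟩
    exact ⟨l ++ l', by rw [flowWord_append, congruence_mul, ← hl, hl']⟩

end Leaf

/-! ### Density in the leaf and in `Sym(n)` -/

section Density

open Filter Topology

variable {p : ℕ} {N : Skew (2 * p)}

theorem EntryAnalytic.flowVec {f : ℝ → Sym (2 * p)} (hf : EntryAnalytic fun s => (f s).1)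
    (i : Idx p) : EntryAnalytic fun s => (flowVec N (f s) i).1 :=
  (hf.mixCoeff _ _ _).lie_const _

theorem linearIndependent_flowVec_coe_iff {X : Sym (2 * p)} :
    (LinearIndependent ℝ fun i => (flowVec N X i).1) ↔ LinearIndependent ℝ (flowVec N X) :=
  ⟨fun h => LinearIndependent.of_comp (symSubmodule (2 * p)).subtype h, fun h =>
    LinearIndependent.map' h (symSubmodule (2 * p)).subtype (Submodule.ker_subtype _)⟩

theorem eventually_linearIndependent_flowVec {f : ℝ → Sym (2 * p)}
    (hf : EntryAnalytic fun s => (f s).1) {s₁ : ℝ} (h : LinearIndependent ℝ (flowVec N (f s₁)))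
    (s₀ : ℝ) : ∀ᶠ s in 𝓝[≠] s₀, LinearIndependent ℝ (flowVec N (f s)) := by
  have := eventually_linearIndependent (fun i => hf.flowVec (N := N) i)
    (linearIndependent_flowVec_coe_iff.2 h) s₀
  filter_upwards [this] with s hs
  exact linearIndependent_flowVec_coe_iff.1 hs

theorem EntryAnalytic.continuous_sym {f : ℝ → Sym (2 * p)}
    (hf : EntryAnalytic fun s => (f s).1) : Continuous f :=
  Continuous.subtype_mk (continuous_matrix fun i j =>
    continuous_iff_continuousAt.2 fun s => (hf i j s).continuousAt) _

/-- A word joining `X` to `Y` gives an analytic path inside the leaf from `X` at `s = 0` to `Y` at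
`s = 1`. Independence at `0` persists at parameters close to `1`. -/
theorem symplecticLeaf_subset_closure (hinv : IsUnit N.1.det) {X : Sym (2 * p)}
    (h : LinearIndependent ℝ (flowVec N X)) :
    symplecticLeaf N X ⊆ closure {Y | Y ∈ symplecticLeaf N X ∧
      LinearIndependent ℝ fun i => leafDifferential N (integrals N i) Y} := by
  intro Y hY
  obtain ⟨l, rfl⟩ := exists_flowWord_of_mem_symplecticLeaf hinv hY
  have hk := entryAnalytic_flowWord N l
  have hf : EntryAnalytic fun s => (congruence (flowWord N l s) X).1 :=
    (hk.transpose.mul (EntryAnalytic.const X.1)).mul hk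
  have hev := eventually_linearIndependent_flowVec (N := N) hf (s₁ := 0)
    (by rwa [flowWord_zero, congruence_one]) 1
  refine mem_closure_of_tendsto (b := 𝓝[≠] (1 : ℝ))
    ((hf.continuous_sym.tendsto 1).mono_left nhdsWithin_le_nhds) ?_
  filter_upwards [hev] with s hs
  exact ⟨congruence_flowWord_mem_symplecticLeaf hinv l s X, linearIndependent_leafDifferential hs⟩

/-- On the line from any `X` to one good point, all nearby points other than possibly `X` are good.
-/
theorem dense_linearIndependent_flowVec (hinv : IsUnit N.1.det) (hdist : DistinctEigenvalues N) :
    Dense {X : Sym (2 * p) | LinearIndependent ℝ (flowVec N X)} := by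
  obtain ⟨X₁, hX₁⟩ := exists_linearIndependent_flowVec hinv hdist
  intro X
  let f : ℝ → Sym (2 * p) := fun s => X + s • (X₁ - X)
  have hf : EntryAnalytic fun s => (f s).1 := (EntryAnalytic.const _).add (EntryAnalytic.id_smul _)
  have hev := eventually_linearIndependent_flowVec (N := N) hf (s₁ := 1) (by simpa [f] using hX₁) 0
  have h0 : f 0 = X := by simp [f]
  refine mem_closure_of_tendsto (b := 𝓝[≠] (0 : ℝ)) (f := f) ?_ hev
  have := (hf.continuous_sym.tendsto 0).mono_left (nhdsWithin_le_nhds (s := {0}ᶜ))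
  rwa [h0] at this

theorem continuous_mixCoeff {n : ℕ} (N : Matrix (Fin n) (Fin n) ℝ) (m j : ℕ) :
    Continuous fun X : Sym n => mixCoeff X.1 N m j := by
  induction m generalizing j with
  | zero =>
    cases j with
    | zero => simpa only [mixCoeff_zero_zero] using continuous_const
    | succ j => simpa only [mixCoeff_zero_succ] using continuous_const
  | succ m ih =>
    cases j with
    | zero =>
      simp only [mixCoeff_succ_zero]
      exact continuous_subtype_val.mul (ih 0)
    | succ j =>
      simp only [mixCoeff_succ_succ]
      exact (continuous_subtype_val.mul (ih (j + 1))).add (continuous_const.mul (ih j))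

open scoped Matrix.Norms.Operator in
theorem isOpen_linearIndependent_flowVec :
    IsOpen {X : Sym (2 * p) | LinearIndependent ℝ (flowVec N X)} := by
  have hc : Continuous fun X : Sym (2 * p) => fun i : Idx p => (flowVec N X i).1 :=
    continuous_pi fun i => by
      have h := continuous_mixCoeff N.1 i.1.1 (2 * i.1.2)
      exact (h.mul continuous_const).sub (continuous_const.mul h)
  have h := (isOpen_setOfPred_linearIndependent (𝕜 := ℝ) (ι := Idx p)
    (E := Matrix (Fin (2 * p)) (Fin (2 * p)) ℝ)).preimage hc
  convert h using 1
  ext X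
  exact linearIndependent_flowVec_coe_iff.symm

theorem liouvilleIntegrableOnLeaf (hinv : IsUnit N.1.det) (hdist : DistinctEigenvalues N)
    {X : Sym (2 * p)} (h : LinearIndependent ℝ (flowVec N X)) :
    LiouvilleIntegrableOnLeaf N X energyHamiltonian (integrals N) := by
  refine ⟨by rw [finrank_leafTangent hdist h, card_idx], fun i Y _ => ?_, fun i j Y _ => ?_,
    symplecticLeaf_subset_closure hinv h⟩
  · rw [energyHamiltonian_eq N]
    exact poissonBracket_integral N (idx_ne_zero i) two_ne_zero _ _ Y
  · exact poissonBracket_integral N (idx_ne_zero i) (idx_ne_zero j) _ _ Y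

end Density

/-! ### Partial derivatives and differentiation under the integral -/

section PartialDerivatives

variable {E : Type*} [NormedAddCommGroup E] [NormedSpace ℝ E]

theorem hasDerivAt_partial_fst {F : ℝ × ℝ → E} (hF : ContDiff ℝ ∞ F) (s t : ℝ) :
    HasDerivAt (fun s => F (s, t)) (fderiv ℝ F (s, t) (1, 0)) s :=
  (hF.differentiable (by simp) (s, t)).hasFDerivAt.comp_hasDerivAt s
    ((hasDerivAt_id s).prodMk (hasDerivAt_const s t))

theorem hasDerivAt_partial_snd {F : ℝ × ℝ → E} (hF : ContDiff ℝ ∞ F) (s t : ℝ) :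
    HasDerivAt (fun t => F (s, t)) (fderiv ℝ F (s, t) (0, 1)) t :=
  (hF.differentiable (by simp) (s, t)).hasFDerivAt.comp_hasDerivAt t
    ((hasDerivAt_const t s).prodMk (hasDerivAt_id t))

theorem contDiff_fderiv_apply {F : ℝ × ℝ → E} (hF : ContDiff ℝ ∞ F) (v : ℝ × ℝ) :
    ContDiff ℝ ∞ fun q => fderiv ℝ F q v :=
  (hF.fderiv_right (m := ∞) (by simp)).clm_apply contDiff_const

theorem fderiv_fderiv_apply_comm {F : ℝ × ℝ → E} (hF : ContDiff ℝ ∞ F) (v w q : ℝ × ℝ) :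
    fderiv ℝ (fun q => fderiv ℝ F q v) q w = fderiv ℝ (fun q => fderiv ℝ F q w) q v := by
  have h1 : DifferentiableAt ℝ (fderiv ℝ F) q :=
    (hF.fderiv_right (m := ∞) (by simp)).differentiable (by simp) q
  rw [fderiv_clm_apply h1 (differentiableAt_const v), fderiv_clm_apply h1 (differentiableAt_const w)]
  have h2 : IsSymmSndFDerivAt ℝ F q := hF.contDiffAt.isSymmSndFDerivAt (by
    rw [minSmoothness_of_isRCLikeNormedField]
    exact WithTop.coe_le_coe.2 le_top)
  simpa using h2 w v

theorem hasDerivAt_integral_of_contDiff {e : ℝ × ℝ → ℝ} (he : ContDiff ℝ ∞ e) (a b s₀ : ℝ) :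
    HasDerivAt (fun s => ∫ t in a..b, e (s, t)) (∫ t in a..b, fderiv ℝ e (s₀, t) (1, 0)) s₀ := by
  have hd := (contDiff_fderiv_apply he (1, 0)).continuous
  obtain ⟨C, hC⟩ := ((isCompact_closedBall s₀ 1).prod
    (isCompact_uIcc (a := a) (b := b))).exists_bound_of_continuousOn hd.continuousOn
  have hc : ∀ s, Continuous fun t => e (s, t) := fun s =>
    he.continuous.comp (Continuous.prodMk continuous_const continuous_id)
  refine (intervalIntegral.hasDerivAt_integral_of_dominated_loc_of_deriv_le
    (F := fun s t => e (s, t)) (F' := fun s t => fderiv ℝ e (s, t) (1, 0)) (bound := fun _ => C)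
    (Metric.ball_mem_nhds s₀ one_pos)
    (Filter.Eventually.of_forall fun s => (hc s).aestronglyMeasurable)
    ((hc s₀).intervalIntegrable a b)
    (hd.comp (Continuous.prodMk continuous_const continuous_id)).aestronglyMeasurable
    (Filter.Eventually.of_forall fun t ht s hs =>
      hC (s, t) ⟨Metric.ball_subset_closedBall hs, Set.uIoc_subset_uIcc ht⟩)
    intervalIntegrable_const
    (Filter.Eventually.of_forall fun t _ s _ => hasDerivAt_partial_fst he s t)).2

end PartialDerivatives

/-! ### First variation of energy and the geodesic equation -/

section Geodesics

open scoped Matrix.Norms.Operator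

variable {n : ℕ} {N : Skew n}

theorem contDiff_of_entries {E : Type*} [NormedAddCommGroup E] [NormedSpace ℝ E]
    {F : E → Matrix (Fin n) (Fin n) ℝ} (h : ∀ i j, ContDiff ℝ ∞ fun q => F q i j) :
    ContDiff ℝ ∞ F := by
  have : F = fun q => ∑ i, ∑ j, F q i j • Matrix.single i j (1 : ℝ) := by
    funext q
    conv_lhs => rw [Matrix.matrix_eq_sum_single (F q)]
    simp only [Matrix.smul_single, smul_eq_mul, mul_one]
  rw [this]
  exact ContDiff.sum fun i _ => ContDiff.sum fun j _ => (h i j).smul contDiff_const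

theorem ContDiff.matrix_transpose {E : Type*} [NormedAddCommGroup E] [NormedSpace ℝ E]
    {F : E → Matrix (Fin n) (Fin n) ℝ} (h : ContDiff ℝ ∞ F) : ContDiff ℝ ∞ fun q => (F q)ᵀ :=
  (Matrix.transposeLinearEquiv (Fin n) (Fin n) ℝ ℝ).toLinearMap.toContinuousLinearMap.contDiff.comp h

theorem ContDiff.matrix_trace {E : Type*} [NormedAddCommGroup E] [NormedSpace ℝ E]
    {F : E → Matrix (Fin n) (Fin n) ℝ} (h : ContDiff ℝ ∞ F) : ContDiff ℝ ∞ fun q => (F q).trace :=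
  (Matrix.traceLinearMap (Fin n) ℝ ℝ).toContinuousLinearMap.contDiff.comp h

theorem hasDerivAt_trace {f : ℝ → Matrix (Fin n) (Fin n) ℝ} {f' : Matrix (Fin n) (Fin n) ℝ}
    {t : ℝ} (h : HasDerivAt f f' t) : HasDerivAt (fun t => (f t).trace) f'.trace t :=
  (Matrix.traceLinearMap (Fin n) ℝ ℝ).toContinuousLinearMap.hasFDerivAt.comp_hasDerivAt t h

theorem velocity_eq {g : ℝ → Matrix (Fin n) (Fin n) ℝ} {g' : Matrix (Fin n) (Fin n) ℝ} {t : ℝ}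
    (h : HasDerivAt g g' t) : velocity g t = g' := by
  ext i j
  exact ((Matrix.entryLinearMap ℝ ℝ i j).toContinuousLinearMap.hasFDerivAt.comp_hasDerivAt
    t h).deriv

theorem spGroup_mul_inv (hinv : IsUnit N.1.det) {g : Matrix (Fin n) (Fin n) ℝ}
    (hg : g ∈ spGroup N) : N.1 * gᵀ * N.1⁻¹ * g = 1 ∧ g * (N.1 * gᵀ * N.1⁻¹) = 1 := by
  have h : N.1 * gᵀ * N.1⁻¹ * g = 1 := by
    have h1 : gᵀ * N.1⁻¹ * g = N.1⁻¹ := hg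
    rw [Matrix.mul_assoc N.1, Matrix.mul_assoc N.1, h1, Matrix.mul_nonsing_inv _ hinv]
  exact ⟨h, mul_eq_one_comm.1 h⟩

/-- In the group `g⁻¹ = N gᵀ N⁻¹`, which makes the body velocity polynomial in the entries of `g`
and `g'`. -/
theorem bodyVelocity_eq (hinv : IsUnit N.1.det) {g : ℝ → Matrix (Fin n) (Fin n) ℝ} {t : ℝ}
    {g' : Matrix (Fin n) (Fin n) ℝ} (hg : g t ∈ spGroup N) (h : HasDerivAt g g' t) :
    bodyVelocity N g t = (g t)ᵀ * N.1⁻¹ * g' := by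
  rw [bodyVelocity, velocity_eq h, Matrix.inv_eq_left_inv (spGroup_mul_inv hinv hg).1,
    Matrix.mul_assoc, Matrix.mul_assoc, Matrix.nonsing_inv_mul_cancel_left _ _ hinv,
    Matrix.mul_assoc]

theorem transpose_trivialized {g : ℝ → Matrix (Fin n) (Fin n) ℝ} {t : ℝ}
    {g' : Matrix (Fin n) (Fin n) ℝ} (hg : ∀ t, g t ∈ spGroup N) (h : HasDerivAt g g' t) :
    ((g t)ᵀ * N.1⁻¹ * g')ᵀ = (g t)ᵀ * N.1⁻¹ * g' := by
  have h1 := ((hasDerivAt_transpose h).mul_const N.1⁻¹).mul h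
  have h2 : (fun t => (g t)ᵀ * N.1⁻¹) * g = fun _ => N.1⁻¹ := funext hg
  rw [h2] at h1
  have h3 := h1.unique (hasDerivAt_const t _)
  rw [Matrix.transpose_mul, Matrix.transpose_mul, Matrix.transpose_transpose,
    transpose_inv_skew, neg_mul, mul_neg, ← Matrix.mul_assoc, neg_eq_iff_add_eq_zero]
  exact h3

theorem eq_mul_trivialized (hinv : IsUnit N.1.det) {g : Matrix (Fin n) (Fin n) ℝ}
    (hg : g ∈ spGroup N) (g' : Matrix (Fin n) (Fin n) ℝ) :
    g' = g * N.1 * (gᵀ * N.1⁻¹ * g') := by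
  have h := (spGroup_mul_inv hinv hg).2
  have e : g * N.1 * (gᵀ * N.1⁻¹ * g') = g * (N.1 * gᵀ * N.1⁻¹) * g' := by
    simp only [Matrix.mul_assoc]
  rw [e, h, Matrix.one_mul]

theorem transpose_mul_trivialized (hinv : IsUnit N.1.det) {g : Matrix (Fin n) (Fin n) ℝ}
    (hg : g ∈ spGroup N) {A B : Matrix (Fin n) (Fin n) ℝ} (hA : Aᵀ = A) :
    (g * N.1 * A)ᵀ * N.1⁻¹ * (g * N.1 * B) = -(A * N.1 * B) := by
  have h1 : gᵀ * N.1⁻¹ * g = N.1⁻¹ := hg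
  rw [Matrix.transpose_mul, Matrix.transpose_mul, skew_transpose, hA]
  have e : A * (-N.1 * gᵀ) * N.1⁻¹ * (g * N.1 * B) =
      -(A * N.1 * ((gᵀ * N.1⁻¹ * g) * N.1 * B)) := by noncomm_ring
  rw [e, h1, Matrix.nonsing_inv_mul _ hinv, Matrix.one_mul]

/-- Cyclicity moves the bracket terms off `ξ`; this is where `[V², N]` comes from. -/
theorem trace_mul_variation (V ξ ξ' : Matrix (Fin n) (Fin n) ℝ) :
    (V * (ξ' - ξ * N.1 * V + V * N.1 * ξ)).trace =
      (V * ξ').trace + (⁅V ^ 2, N.1⁆ * ξ).trace := by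
  have h1 : (V * (ξ * N.1 * V)).trace = (N.1 * V ^ 2 * ξ).trace := by
    rw [Matrix.mul_assoc ξ, ← Matrix.mul_assoc, Matrix.trace_mul_comm, sq]
    simp only [Matrix.mul_assoc]
  rw [mul_add, mul_sub, Matrix.trace_add, Matrix.trace_sub, h1, Ring.lie_def, sub_mul,
    Matrix.trace_sub, sq]
  simp only [Matrix.mul_assoc]
  ring

/-- The first variation formula for the energy of a curve in the symplectic group. -/
theorem hasDerivAt_curveEnergy (hinv : IsUnit N.1.det) {a b : ℝ}
    {Γ : ℝ → ℝ → Matrix (Fin n) (Fin n) ℝ}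
    (hΓ : ∀ i j, ContDiff ℝ ∞ fun q : ℝ × ℝ => Γ q.1 q.2 i j) (hsp : ∀ s t, Γ s t ∈ spGroup N)
    (ha : ∀ s, Γ s a = Γ 0 a) (hb : ∀ s, Γ s b = Γ 0 b) :
    HasDerivAt (fun s => curveEnergy N a b (Γ s))
      (∫ t in a..b, ((⁅(bodyVelocity N (Γ 0) t) ^ 2, N.1⁆ - deriv (bodyVelocity N (Γ 0)) t) *
        ((Γ 0 t)ᵀ * N.1⁻¹ * deriv (fun s => Γ s t) 0)).trace) 0 := by
  let F : ℝ × ℝ → Matrix (Fin n) (Fin n) ℝ := fun q => Γ q.1 q.2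
  have hF : ContDiff ℝ ∞ F := contDiff_of_entries hΓ
  let Fs : ℝ × ℝ → Matrix (Fin n) (Fin n) ℝ := fun q => fderiv ℝ F q (1, 0)
  let Ft : ℝ × ℝ → Matrix (Fin n) (Fin n) ℝ := fun q => fderiv ℝ F q (0, 1)
  have hFs : ContDiff ℝ ∞ Fs := contDiff_fderiv_apply hF _
  have hFt : ContDiff ℝ ∞ Ft := contDiff_fderiv_apply hF _
  have dFs : ∀ s t, HasDerivAt (fun s => Γ s t) (Fs (s, t)) s := hasDerivAt_partial_fst hF
  have dFt : ∀ s t, HasDerivAt (Γ s) (Ft (s, t)) t := hasDerivAt_partial_snd hF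
  let V : ℝ × ℝ → Matrix (Fin n) (Fin n) ℝ := fun q => (F q)ᵀ * N.1⁻¹ * Ft q
  let ξ : ℝ × ℝ → Matrix (Fin n) (Fin n) ℝ := fun q => (F q)ᵀ * N.1⁻¹ * Fs q
  have hFT : ContDiff ℝ ∞ fun q => (F q)ᵀ * N.1⁻¹ :=
    (ContDiff.matrix_transpose hF).mul contDiff_const
  have hV : ContDiff ℝ ∞ V := hFT.mul hFt
  have hξ : ContDiff ℝ ∞ ξ := hFT.mul hFs
  have hVb : ∀ s t, bodyVelocity N (Γ s) t = V (s, t) := fun s t =>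
    bodyVelocity_eq hinv (hsp s t) (dFt s t)
  have hVT : ∀ s t, (V (s, t))ᵀ = V (s, t) := fun s t =>
    transpose_trivialized (hsp s) (dFt s t)
  have hξT : ∀ s t, (ξ (s, t))ᵀ = ξ (s, t) := fun s t =>
    transpose_trivialized (g := fun s => Γ s t) (t := s) (fun s => hsp s t) (dFs s t)
  have dV : ∀ t, HasDerivAt (fun t => V (0, t)) (fderiv ℝ V (0, t) (0, 1)) t :=
    hasDerivAt_partial_snd hV 0
  have dξ : ∀ t, HasDerivAt (fun t => ξ (0, t)) (fderiv ℝ ξ (0, t) (0, 1)) t :=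
    hasDerivAt_partial_snd hξ 0
  -- the variation of the body velocity
  have key : ∀ t, fderiv ℝ V (0, t) (1, 0) = fderiv ℝ ξ (0, t) (0, 1) -
      ξ (0, t) * N.1 * V (0, t) + V (0, t) * N.1 * ξ (0, t) := by
    intro t
    have h1 : fderiv ℝ V (0, t) (1, 0) = (Fs (0, t))ᵀ * N.1⁻¹ * Ft (0, t) +
        (F (0, t))ᵀ * N.1⁻¹ * fderiv ℝ Ft (0, t) (1, 0) :=
      (hasDerivAt_partial_fst hV 0 t).unique
        (((hasDerivAt_transpose (dFs 0 t)).mul_const N.1⁻¹).mul (hasDerivAt_partial_fst hFt 0 t))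
    have h2 : fderiv ℝ ξ (0, t) (0, 1) = (Ft (0, t))ᵀ * N.1⁻¹ * Fs (0, t) +
        (F (0, t))ᵀ * N.1⁻¹ * fderiv ℝ Fs (0, t) (0, 1) :=
      (hasDerivAt_partial_snd hξ 0 t).unique
        (((hasDerivAt_transpose (dFt 0 t)).mul_const N.1⁻¹).mul (hasDerivAt_partial_snd hFs 0 t))
    -- Mixed partials agree, so the second-order terms of `∂V/∂s` and `∂ξ/∂t` cancel and only the
    -- bracket terms remain.
    have h3 : fderiv ℝ Ft (0, t) (1, 0) = fderiv ℝ Fs (0, t) (0, 1) :=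
      fderiv_fderiv_apply_comm hF _ _ _
    have h4 : Fs (0, t) = F (0, t) * N.1 * ξ (0, t) := eq_mul_trivialized hinv (hsp 0 t) _
    have h5 : Ft (0, t) = F (0, t) * N.1 * V (0, t) := eq_mul_trivialized hinv (hsp 0 t) _
    have h6 : (Fs (0, t))ᵀ * N.1⁻¹ * Ft (0, t) = -(ξ (0, t) * N.1 * V (0, t)) := by
      rw [h4, h5]
      exact transpose_mul_trivialized hinv (hsp 0 t) (hξT 0 t)
    have h7 : (Ft (0, t))ᵀ * N.1⁻¹ * Fs (0, t) = -(V (0, t) * N.1 * ξ (0, t)) := by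
      rw [h4, h5]
      exact transpose_mul_trivialized hinv (hsp 0 t) (hVT 0 t)
    rw [h1, h2, h3, h6, h7]
    abel
  have hξa : ξ (0, a) = 0 := by
    have h := dFs 0 a
    rw [funext ha] at h
    change _ * Fs (0, a) = 0
    rw [h.unique (hasDerivAt_const _ _), mul_zero]
  have hξb : ξ (0, b) = 0 := by
    have h := dFs 0 b
    rw [funext hb] at h
    change _ * Fs (0, b) = 0
    rw [h.unique (hasDerivAt_const _ _), mul_zero]
  let e : ℝ × ℝ → ℝ := fun q => (V q * V q).trace
  have he : ContDiff ℝ ∞ e := ContDiff.matrix_trace (hV.mul hV)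
  have hE : (fun s => curveEnergy N a b (Γ s)) = fun s => (1 / 2 : ℝ) * ∫ t in a..b, e (s, t) := by
    funext s
    simp only [curveEnergy, hVb]
    rfl
  rw [hE]
  refine ((hasDerivAt_integral_of_contDiff he a b 0).const_mul (1 / 2 : ℝ)).congr_deriv ?_
  have h0 : bodyVelocity N (Γ 0) = fun t => V (0, t) := funext fun t => hVb 0 t
  have hds : ∀ t, fderiv ℝ e (0, t) (1, 0) =
      2 * ((V (0, t) * fderiv ℝ ξ (0, t) (0, 1)).trace +
        (⁅V (0, t) ^ 2, N.1⁆ * ξ (0, t)).trace) := by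
    intro t
    have h1 := hasDerivAt_partial_fst hV 0 t
    have h2 := (hasDerivAt_partial_fst he 0 t).unique (hasDerivAt_trace (h1.mul h1))
    rw [← trace_mul_variation, ← key, h2, two_mul]
    exact (Matrix.trace_add _ _).trans (congrArg (· + _) (Matrix.trace_mul_comm _ _))
  have hint : ∀ t, HasDerivAt (fun t => (V (0, t) * ξ (0, t)).trace)
      ((fderiv ℝ V (0, t) (0, 1) * ξ (0, t)).trace +
        (V (0, t) * fderiv ℝ ξ (0, t) (0, 1)).trace) t := fun t => by
    rw [← Matrix.trace_add]
    exact hasDerivAt_trace ((dV t).mul (dξ t))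
  have cpair : ∀ {G : ℝ × ℝ → Matrix (Fin n) (Fin n) ℝ}, ContDiff ℝ ∞ G →
      Continuous fun t : ℝ => G (0, t) := fun hG =>
    hG.continuous.comp (Continuous.prodMk continuous_const continuous_id)
  have cV := cpair hV
  have cξ := cpair hξ
  have cVt := cpair (contDiff_fderiv_apply hV (0, 1))
  have cξt := cpair (contDiff_fderiv_apply hξ (0, 1))
  have c1 : Continuous fun t => (fderiv ℝ V (0, t) (0, 1) * ξ (0, t)).trace :=
    (cVt.mul cξ).matrix_trace
  have c2 : Continuous fun t => (V (0, t) * fderiv ℝ ξ (0, t) (0, 1)).trace :=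
    (cV.mul cξt).matrix_trace
  have c3 : Continuous fun t => (⁅V (0, t) ^ 2, N.1⁆ * ξ (0, t)).trace := by
    simp only [Ring.lie_def]
    exact ((((cV.pow 2).mul continuous_const).sub (continuous_const.mul (cV.pow 2))).mul
      cξ).matrix_trace
  -- Integration by parts; the boundary terms vanish because the endpoints are fixed.
  have hparts := intervalIntegral.integral_eq_sub_of_hasDerivAt (a := a) (b := b)
    (fun t _ => hint t) ((c1.add c2).intervalIntegrable a b)
  rw [hξa, hξb, mul_zero, mul_zero, sub_self,
    intervalIntegral.integral_add (c1.intervalIntegrable a b) (c2.intervalIntegrable a b)] at hparts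
  have hrhs : ∀ t, ((⁅(bodyVelocity N (Γ 0) t) ^ 2, N.1⁆ - deriv (bodyVelocity N (Γ 0)) t) *
      ((Γ 0 t)ᵀ * N.1⁻¹ * deriv (fun s => Γ s t) 0)).trace =
      (⁅V (0, t) ^ 2, N.1⁆ * ξ (0, t)).trace - (fderiv ℝ V (0, t) (0, 1) * ξ (0, t)).trace := by
    intro t
    have h1 : deriv (bodyVelocity N (Γ 0)) t = fderiv ℝ V (0, t) (0, 1) := by
      rw [h0]
      exact (dV t).deriv
    have h2 : deriv (fun s => Γ s t) 0 = Fs (0, t) := (dFs 0 t).deriv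
    rw [h1, h2, hVb, sub_mul, Matrix.trace_sub]
  simp only [hds, hrhs]
  rw [intervalIntegral.integral_const_mul,
    intervalIntegral.integral_add (c2.intervalIntegrable a b) (c3.intervalIntegrable a b),
    intervalIntegral.integral_sub (c3.intervalIntegrable a b) (c1.intervalIntegrable a b)]
  linarith

/-- With `E = v vᵀ`, skewness gives `vᵀ N v = 0`, hence `E N E = 0`: the term quadratic in `c`
vanishes and the linear ones cancel. So variations need no exponential. -/
theorem transvection_mem_spGroup (hinv : IsUnit N.1.det) {g : Matrix (Fin n) (Fin n) ℝ}
    (hg : g ∈ spGroup N) (v : Fin n → ℝ) (c : ℝ) :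
    g * (1 + c • (N.1 * Matrix.vecMulVec v v)) ∈ spGroup N := by
  set E := Matrix.vecMulVec v v with hE
  have hET : Eᵀ = E := by rw [hE, Matrix.transpose_vecMulVec]
  have hENE : E * N.1 * E = 0 := by
    have h1 : v ⬝ᵥ (N.1 *ᵥ v) = 0 := by
      have h2 : v ⬝ᵥ (N.1 *ᵥ v) = -(v ⬝ᵥ (N.1 *ᵥ v)) := by
        conv_lhs => rw [Matrix.dotProduct_mulVec, ← Matrix.mulVec_transpose, skew_transpose,
          Matrix.neg_mulVec, neg_dotProduct, dotProduct_comm]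
      linarith
    rw [hE, Matrix.vecMulVec_mul, Matrix.vecMulVec_mul_vecMulVec, ← Matrix.dotProduct_mulVec, h1,
      zero_smul]
    simp
  have h1 : gᵀ * N.1⁻¹ * g = N.1⁻¹ := hg
  change (_)ᵀ * N.1⁻¹ * _ = _
  rw [Matrix.transpose_mul, Matrix.transpose_add, Matrix.transpose_one, Matrix.transpose_smul,
    Matrix.transpose_mul, hET, skew_transpose]
  have e : (1 + c • (E * -N.1)) * gᵀ * N.1⁻¹ * (g * (1 + c • (N.1 * E))) =
      (1 + c • (E * -N.1)) * (gᵀ * N.1⁻¹ * g) * (1 + c • (N.1 * E)) := by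
    simp only [Matrix.mul_assoc]
  rw [e, h1]
  have e2 : (1 + c • (E * -N.1)) * N.1⁻¹ * (1 + c • (N.1 * E)) =
      N.1⁻¹ + c • (N.1⁻¹ * N.1 * E) - c • (E * (N.1 * N.1⁻¹)) -
        c • c • (E * (N.1 * N.1⁻¹) * N.1 * E) := by
    simp only [add_mul, mul_add, Matrix.one_mul, Matrix.mul_one, smul_mul_assoc, mul_smul_comm,
      smul_add,  mul_neg, neg_mul, smul_neg, Matrix.mul_assoc]
    abel
  rw [e2, Matrix.mul_nonsing_inv _ hinv, Matrix.nonsing_inv_mul _ hinv, Matrix.mul_one,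
    Matrix.one_mul, hENE, smul_zero, smul_zero, sub_zero, add_sub_cancel_right]

/-- Polarization of the quadratic form of `G`. -/
theorem eq_zero_of_trace_mul_vecMulVec {G : Matrix (Fin n) (Fin n) ℝ} (hG : Gᵀ = G)
    (h : ∀ v, (G * Matrix.vecMulVec v v).trace = 0) : G = 0 := by
  have h' : ∀ v, v ⬝ᵥ (G *ᵥ v) = 0 := fun v => by
    rw [← h v, Matrix.mul_vecMulVec, Matrix.trace_vecMulVec, dotProduct_comm]
  ext i j
  have h1 := h' (Pi.single i 1 + Pi.single j 1)
  have h2 := h' (Pi.single i 1)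
  have h3 := h' (Pi.single j 1)
  have h4 : G j i = G i j := congrFun (congrFun hG i) j
  simp only [Matrix.mulVec_add, dotProduct_add, add_dotProduct, Matrix.mulVec_single_one,
    single_dotProduct, one_mul, Matrix.col_apply] at h1 h2 h3
  rw [Matrix.zero_apply]
  linarith

theorem isGeodesic_iff (hinv : IsUnit N.1.det) {g : ℝ → Matrix (Fin n) (Fin n) ℝ}
    (hg : ∀ i j, ContDiff ℝ ∞ fun t => g t i j) (hsp : ∀ t, g t ∈ spGroup N) :
    IsGeodesic N g ↔
      ∀ t, HasDerivAt (bodyVelocity N g) ⁅(bodyVelocity N g t) ^ 2, N.1⁆ t := by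
  constructor
  · intro hgeo
    have hg' : ContDiff ℝ ∞ g := contDiff_of_entries hg
    have hdg : ContDiff ℝ ∞ (deriv g) := (contDiff_infty_iff_deriv.1 hg').2
    have hgd : ∀ t, HasDerivAt g (deriv g t) t := fun t =>
      (hg'.differentiable (by simp) t).hasDerivAt
    have hbv : bodyVelocity N g = fun t => (g t)ᵀ * N.1⁻¹ * deriv g t :=
      funext fun t => bodyVelocity_eq hinv (hsp t) (hgd t)
    have hX : ContDiff ℝ ∞ (bodyVelocity N g) := by
      rw [hbv]
      exact ((ContDiff.matrix_transpose hg').mul contDiff_const).mul hdg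
    have hXd : ∀ t, HasDerivAt (bodyVelocity N g) (deriv (bodyVelocity N g) t) t := fun t =>
      (hX.differentiable (by simp) t).hasDerivAt
    have hXT : ∀ t, (bodyVelocity N g t)ᵀ = bodyVelocity N g t := fun t => by
      rw [hbv]
      exact transpose_trivialized hsp (hgd t)
    let G : ℝ → Matrix (Fin n) (Fin n) ℝ := fun t =>
      ⁅(bodyVelocity N g t) ^ 2, N.1⁆ - deriv (bodyVelocity N g) t
    have hG : ContDiff ℝ ∞ G := by
      simp only [G, Ring.lie_def]
      exact (((hX.pow 2).mul contDiff_const).sub (contDiff_const.mul (hX.pow 2))).sub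
        (contDiff_infty_iff_deriv.1 hX).2
    have hGT : ∀ t, (G t)ᵀ = G t := by
      intro t
      have h1 : (deriv (bodyVelocity N g) t)ᵀ = deriv (bodyVelocity N g) t := by
        have h2 := hasDerivAt_transpose (hXd t)
        rw [funext hXT] at h2
        exact h2.unique (hXd t)
      simp only [G, Ring.lie_def, Matrix.transpose_sub, Matrix.transpose_mul, Matrix.transpose_pow,
        hXT, h1, skew_transpose]
      noncomm_ring
    intro t₀
    suffices h : G t₀ = 0 by
      have h1 := hXd t₀
      rwa [← sub_eq_zero.1 h] at h1
    refine eq_zero_of_trace_mul_vecMulVec (hGT t₀) fun v => ?_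
    let ψ : ℝ → ℝ := fun t => (G t * Matrix.vecMulVec v v).trace
    have hψ : ContDiff ℝ ∞ ψ := ContDiff.matrix_trace (hG.mul contDiff_const)
    -- The quadratic factor vanishes at both endpoints and is positive between them; the factor `ψ`
    -- turns the first variation into the integral of a weight times `ψ²`, which is positive unless
    -- `ψ t₀ = 0`.
    let φ : ℝ → ℝ := fun t => (t - (t₀ - 1)) * (t₀ + 1 - t) * ψ t
    have hφ : ContDiff ℝ ∞ φ :=
      ((contDiff_id.sub contDiff_const).mul (contDiff_const.sub contDiff_id)).mul hψ
    let Γ : ℝ → ℝ → Matrix (Fin n) (Fin n) ℝ := fun s t =>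
      g t * (1 + (s * φ t) • (N.1 * Matrix.vecMulVec v v))
    have hΓ0 : Γ 0 = g := funext fun t => by simp [Γ]
    have hΓ : ∀ i j, ContDiff ℝ ∞ fun q : ℝ × ℝ => Γ q.1 q.2 i j := by
      have h1 : ContDiff ℝ ∞ fun q : ℝ × ℝ => Γ q.1 q.2 :=
        (hg'.comp contDiff_snd).mul
          (contDiff_const.add ((contDiff_fst.mul (hφ.comp contDiff_snd)).smul contDiff_const))
      exact fun i j => (Matrix.entryLinearMap ℝ ℝ i j).toContinuousLinearMap.contDiff.comp h1
    have hΓsp : ∀ s t, Γ s t ∈ spGroup N := fun s t =>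
      transvection_mem_spGroup hinv (hsp t) v _
    have hΓa : ∀ s, Γ s (t₀ - 1) = g (t₀ - 1) := fun s => by simp [Γ, φ]
    have hΓb : ∀ s, Γ s (t₀ + 1) = g (t₀ + 1) := fun s => by simp [Γ, φ]
    have h1 := hgeo (t₀ - 1) (t₀ + 1) (by linarith) Γ hΓ hΓsp hΓ0 hΓa hΓb
    have h2 := hasDerivAt_curveEnergy hinv hΓ hΓsp (fun s => by rw [hΓ0, hΓa])
      (fun s => by rw [hΓ0, hΓb])
    have h3 := h2.unique h1
    have hξ : ∀ t, (Γ 0 t)ᵀ * N.1⁻¹ * deriv (fun s => Γ s t) 0 =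
        φ t • Matrix.vecMulVec v v := by
      intro t
      have h4 : HasDerivAt (fun s => Γ s t)
          (g t * ((1 * φ t) • (N.1 * Matrix.vecMulVec v v))) 0 :=
        ((((hasDerivAt_id (0 : ℝ)).mul_const (φ t)).smul_const
          (N.1 * Matrix.vecMulVec v v)).const_add 1).const_mul (g t)
      have h5 : (g t)ᵀ * N.1⁻¹ * g t = N.1⁻¹ := hsp t
      have h6 : deriv (fun s => Γ s t) 0 = g t * ((1 * φ t) • (N.1 * Matrix.vecMulVec v v)) :=
        h4.deriv
      rw [h6, hΓ0, ← Matrix.mul_assoc, h5, one_mul, mul_smul_comm,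
        Matrix.nonsing_inv_mul_cancel_left _ _ hinv]
    by_contra hne
    have hpos : 0 < ∫ t in (t₀ - 1)..(t₀ + 1), (t - (t₀ - 1)) * (t₀ + 1 - t) * ψ t ^ 2 := by
      refine intervalIntegral.integral_pos (by linarith) ?_ (fun t ht => ?_)
        ⟨t₀, ⟨by linarith, by linarith⟩, ?_⟩
      · exact (((continuous_id.sub continuous_const).mul (continuous_const.sub continuous_id)).mul
          (hψ.continuous.pow 2)).continuousOn
      · exact mul_nonneg (mul_nonneg (by linarith [ht.1]) (by linarith [ht.2])) (sq_nonneg _)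
      · have : (0 : ℝ) < ψ t₀ ^ 2 := by positivity
        have h6 : (t₀ - (t₀ - 1)) * (t₀ + 1 - t₀) * ψ t₀ ^ 2 = ψ t₀ ^ 2 := by ring
        rwa [h6]
    have h7 : ∀ t, ((⁅(bodyVelocity N (Γ 0) t) ^ 2, N.1⁆ - deriv (bodyVelocity N (Γ 0)) t) *
        ((Γ 0 t)ᵀ * N.1⁻¹ * deriv (fun s => Γ s t) 0)).trace =
        (t - (t₀ - 1)) * (t₀ + 1 - t) * ψ t ^ 2 := by
      intro t
      rw [hξ, hΓ0, mul_smul_comm, Matrix.trace_smul, smul_eq_mul]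
      change φ t * ψ t = _
      simp only [φ]
      ring
    simp only [h7] at h3
    exact hpos.ne' h3
  · intro hode a b _ Γ hΓ hΓsp hΓ0 hΓa hΓb
    have h := hasDerivAt_curveEnergy hinv hΓ hΓsp (fun s => by rw [hΓ0, hΓa])
      (fun s => by rw [hΓ0, hΓb])
    refine h.congr_deriv ?_
    have h1 : ∀ t, deriv (bodyVelocity N (Γ 0)) t = ⁅(bodyVelocity N (Γ 0) t) ^ 2, N.1⁆ :=
      fun t => by
        rw [hΓ0]
        exact (hode t).deriv
    simp only [h1, sub_self, zero_mul, Matrix.trace_zero, intervalIntegral.integral_zero]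

end Geodesics

end SymFlow

end

/-! ### Assembly of the theorem -/

theorem mainTheorem1 (p : ℕ) (N : SymFlow.Skew (2 * p)) (hinv : IsUnit N.1.det)
    (hdist : SymFlow.DistinctEigenvalues N) :
    -- `X ↦ N X` is a Lie algebra isomorphism from `(Sym(n), [·,·]_N)` onto `sp(ℝⁿ, N⁻¹)`
    (Function.Injective (fun X : SymFlow.Sym (2 * p) => N.1 * X.1) ∧
      Set.range (fun X : SymFlow.Sym (2 * p) => N.1 * X.1) =
        (skewAdjointMatricesLieSubalgebra N.1⁻¹ :
          Set (Matrix (Fin (2 * p)) (Fin (2 * p)) ℝ)) ∧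
      ∀ X Y : SymFlow.Sym (2 * p),
        N.1 * (SymFlow.bracketN N X Y).1 = ⁅N.1 * X.1, N.1 * Y.1⁆) ∧
    -- `X' = [X², N]` is the equation of the geodesics of the left-invariant metric on the group
    (∀ g : ℝ → Matrix (Fin (2 * p)) (Fin (2 * p)) ℝ,
      (∀ i j, ContDiff ℝ ∞ fun t => g t i j) → (∀ t, g t ∈ SymFlow.spGroup N) →
      (SymFlow.IsGeodesic N g ↔
        ∀ t, HasDerivAt (SymFlow.bodyVelocity N g) ⁅(SymFlow.bodyVelocity N g t) ^ 2, N.1⁆ t)) ∧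
    -- `X' = [X², N]` is the Hamiltonian system of `(1/2) trace (X²)`
    (∀ X : SymFlow.Sym (2 * p),
      (SymFlow.hamiltonianField N SymFlow.energyHamiltonian X).1 = ⁅X.1 ^ 2, N.1⁆) ∧
    -- there are `p²` functions `h_{k,2r}`, and they are in involution
    Fintype.card (SymFlow.Idx p) = p ^ 2 ∧
    (∀ (i j : SymFlow.Idx p) (X : SymFlow.Sym (2 * p)),
      SymFlow.poissonBracket N (SymFlow.integrals N i) (SymFlow.integrals N j) X = 0) ∧
    -- generically they are independent and the system is Liouville integrable on the leaf
    ∃ U : Set (SymFlow.Sym (2 * p)), IsOpen U ∧ Dense U ∧ ∀ X ∈ U,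
      (LinearIndependent ℝ fun i : SymFlow.Idx p => fderiv ℝ (SymFlow.integrals N i) X) ∧
      SymFlow.LiouvilleIntegrableOnLeaf N X SymFlow.energyHamiltonian (SymFlow.integrals N) := by
  refine ⟨⟨SymFlow.mul_left_injective_sym hinv, SymFlow.range_mul_left_sym hinv,
      SymFlow.bracketN_mul N⟩, fun g hg hsp => SymFlow.isGeodesic_iff hinv hg hsp,
    SymFlow.hamiltonianField_energyHamiltonian N, SymFlow.card_idx p,
    fun i j X => SymFlow.poissonBracket_integral N (SymFlow.idx_ne_zero i) (SymFlow.idx_ne_zero j)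
      _ _ X,
    {X | LinearIndependent ℝ (SymFlow.flowVec N X)}, SymFlow.isOpen_linearIndependent_flowVec,
    SymFlow.dense_linearIndependent_flowVec hinv hdist, fun X hX =>
      ⟨SymFlow.linearIndependent_fderiv hX, SymFlow.liouvilleIntegrableOnLeaf hinv hdist hX⟩⟩
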